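/- Let $A$ be a separable, nuclear, unital $C^*$-algebra carrying a compact quantum group structure, i.e. a unital $*$-homomorphism $\Delta\colon A\to A\otimes A$ with $(\Delta\otimes\mathrm{id})\Delta=(\mathrm{id}\otimes\Delta)\Delta$ such that the linear spans of $\Delta(A)(A\otimes 1)$ and $\Delta(A)(1\otimes A)$ are dense in $A\otimes A$, and let $f$ be a faithful right Haar state on $A$, i.e. a faithful state with $(f\otimes\mathrm{id})\Delta(a)=f(a)1$ for all $a\in A$. Let $B$ be a unital $C^*$-algebra and let $\delta\colon B\to A\otimes B$ be a left co-action, i.e. a $*$-homomorphism with $(\mathrm{id}\otimes\delta)\delta=(\Delta\otimes\mathrm{id})\delta$ such that the linear span of $\delta(B)(A\otimes 1)$ is dense in $A\otimes B$. Let $\eta$ be a faithful state on $B$ that is invariant, i.e. $(\mathrm{id}\otimes\eta)\delta(b)=\eta(b)1$ for all $b\in B$. Let $I=\mathbb N$ if $A$ is infinite-dimensional, and let $I=\{1,\dots,n\}$ if $\dim_{\mathbb C}A=n<\infty$. Let $\mathcal H_B$ be the standard Hilbert $B$-module of all families $(b_i)_{i\in I}$ in $B$ for which $\sum_i b_i^*b_i$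 converges in norm, with inner product $\langle (b_i),(b_i')\rangle=\sum_i b_i^*b_i'$, on which $B$ acts from the left by $b(b_i)=(bb_i)$. Regard $A\otimes B$ as a Hilbert module over itself, with $\langle x,y\rangle=x^*y$. For a Hilbert module $E$ over a $C^*$-algebra $C$ and a faithful state $g$ on $C$, the enveloping Hilbert space of $E$ with respect to $g$ is the completion of $E$ for the scalar product $g(\langle x,y\rangle)$. Then the product state $f\otimes\eta$ on $A\otimes B$ is faithful, and there is a densely defined $\mathbb C$-linear map $W\colon\mathcal H_B\supseteq D\to A\otimes B$, whose domain $D$ contains all finitely supported families and satisfies $BD\subseteq D$, such that $$W(bx)=\delta(b)W(x)\qquad\text{for all } b\in B,\ x\in D,$$ and such that $W$ extends to a unitary from the enveloping Hilbert space of $\mathcal H_B$ with respect to $\eta$ onto the enveloping Hilbert space of $A\otimes B$ with respect to $f\otimes\eta$. -/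

import Mathlib

open scoped TensorProduct ComplexOrder InnerProductSpace

universe u

noncomputable section

/-- A C⋆-seminorm on a unital complex ⋆-algebra. -/
structure CStarSeminorm (R : Type*) [Ring R] [StarRing R] [Algebra ℂ R] extends
    Seminorm ℂ R where
  mul_le' : ∀ x y, toFun (x * y) ≤ toFun x * toFun y
  star_mul_self' : ∀ x, toFun (star x * x) = toFun x ^ 2

namespace CStarSeminorm

section
variable {R : Type*} [Ring R] [StarRing R] [Algebra ℂ R]

instance : CoeFun (CStarSeminorm R) (fun _ => R → ℝ) := ⟨fun p => p.toSeminorm⟩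

instance : Inhabited (CStarSeminorm R) :=
  ⟨{ toSeminorm := 0
     mul_le' := fun _ _ => by change (0 : ℝ) ≤ 0 * 0; simp
     star_mul_self' := fun _ => by change (0 : ℝ) = 0 ^ 2; simp }⟩

lemma nonneg (p : CStarSeminorm R) (x : R) : 0 ≤ p x := apply_nonneg p.toSeminorm x

lemma mul_le (p : CStarSeminorm R) (x y : R) : p (x * y) ≤ p x * p y := p.mul_le' x y

lemma star_mul_self (p : CStarSeminorm R) (x : R) : p (star x * x) = p x ^ 2 :=
  p.star_mul_self' x

lemma one_le (p : CStarSeminorm R) : p 1 ≤ 1 := by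
  have h := p.star_mul_self 1
  rw [star_one, one_mul] at h
  nlinarith [p.nonneg 1]

lemma unitary_le (p : CStarSeminorm R) (x : R) (hx : star x * x = 1) : p x ≤ 1 := by
  have h := p.star_mul_self x
  rw [hx] at h
  nlinarith [p.nonneg x, p.one_le]

lemma star_le (p : CStarSeminorm R) (x : R) : p x ≤ p (star x) := by
  have h := p.star_mul_self x
  have h2 := p.mul_le (star x) x
  rcases (p.nonneg x).eq_or_lt with h0 | h0
  · rw [← h0]; exact p.nonneg _
  · rw [h, sq] at h2
    exact le_of_mul_le_mul_right h2 h0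

lemma map_star (p : CStarSeminorm R) (x : R) : p (star x) = p x :=
  le_antisymm (by simpa using p.star_le (star x)) (p.star_le x)

/-- A C⋆-norm is a C⋆-seminorm that vanishes only at zero. -/
def IsNorm (p : CStarSeminorm R) : Prop := ∀ x, p x = 0 → x = 0

end

variable {A B : Type*} [CStarAlgebra A] [CStarAlgebra B]

lemma map_le {R : Type*} [Ring R] [StarRing R] [Algebra ℂ R] (p : CStarSeminorm R)
    (φ : A →⋆ₐ[ℂ] R) (a : A) : p (φ a) ≤ 2 * ‖a‖ := by
  obtain ⟨w, c, hx, hc⟩ := CStarAlgebra.exists_sum_four_unitary a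
  have h1 : ∀ i, p (φ (c i • (w i : A))) ≤ ‖a‖ / 2 := by
    intro i
    rw [map_smul, map_smul_eq_mul]
    have h2 : p (φ (w i : A)) ≤ 1 := by
      apply p.unitary_le
      rw [← StarHomClass.map_star φ, ← map_mul, Unitary.coe_star_mul_self, map_one]
    nlinarith [hc i, p.nonneg (φ (w i : A)), norm_nonneg (c i)]
  have h2 : p (φ a) ≤ ∑ _i : Fin 4, ‖a‖ / 2 := by
    conv_lhs => rw [hx, map_sum]
    simp only [Fin.sum_univ_four] at *
    refine (map_add_le_add p.toSeminorm _ _).trans ?_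
    refine add_le_add ((map_add_le_add p.toSeminorm _ _).trans ?_) (h1 3)
    exact add_le_add ((map_add_le_add p.toSeminorm _ _).trans (add_le_add (h1 0) (h1 1))) (h1 2)
  refine h2.trans_eq ?_
  simp only [Finset.sum_const, Finset.card_univ, Fintype.card_fin, nsmul_eq_mul]
  push_cast
  ring

/-- The C⋆-seminorm `x ↦ ‖π x‖` for a ⋆-homomorphism `π` into a C⋆-algebra. -/
def ofHom {R : Type*} [Ring R] [StarRing R] [Algebra ℂ R] (π : R →⋆ₐ[ℂ] A) : CStarSeminorm R where
  toFun x := ‖π x‖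
  map_zero' := by simp
  add_le' x y := by rw [map_add]; exact norm_add_le _ _
  neg' x := by simp
  smul' c x := by rw [map_smul, norm_smul]
  mul_le' x y := by rw [map_mul]; exact norm_mul_le _ _
  star_mul_self' x := by rw [map_mul, StarHomClass.map_star, CStarRing.norm_star_mul_self, sq]

end CStarSeminorm

section Tensor
variable (A B : Type*) [CStarAlgebra A] [CStarAlgebra B]

/-- The canonical embedding `a ↦ a ⊗ 1` into the algebraic tensor product. -/
def algInl : A →⋆ₐ[ℂ] A ⊗[ℂ] B where
  __ := (Algebra.TensorProduct.includeLeft : A →ₐ[ℂ] A ⊗[ℂ] B)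
  map_star' a := by simp

/-- The canonical embedding `b ↦ 1 ⊗ b` into the algebraic tensor product. -/
def algInr : B →⋆ₐ[ℂ] A ⊗[ℂ] B where
  __ := (Algebra.TensorProduct.includeRight : B →ₐ[ℂ] A ⊗[ℂ] B)
  map_star' a := by simp

variable {A B}

lemma CStarSeminorm.bddAbove (x : A ⊗[ℂ] B) :
    BddAbove (Set.range fun p : CStarSeminorm (A ⊗[ℂ] B) => p x) := by
  induction x with
  | zero => exact ⟨0, by rintro _ ⟨p, rfl⟩; exact (map_zero p.toSeminorm).le⟩
  | tmul a b =>
    refine ⟨(2 * ‖a‖) * (2 * ‖b‖), ?_⟩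
    rintro _ ⟨p, rfl⟩
    have h : a ⊗ₜ[ℂ] b = algInl A B a * algInr A B b := by
      change _ = (a ⊗ₜ[ℂ] (1 : B)) * ((1 : A) ⊗ₜ[ℂ] b)
      simp
    change p (a ⊗ₜ[ℂ] b) ≤ _
    rw [h]
    exact (p.mul_le _ _).trans (mul_le_mul (p.map_le _ _) (p.map_le _ _) (p.nonneg _) (by positivity))
  | add x y hx hy =>
    obtain ⟨C, hC⟩ := hx
    obtain ⟨D, hD⟩ := hy
    refine ⟨C + D, ?_⟩
    rintro _ ⟨p, rfl⟩
    exact (map_add_le_add p.toSeminorm _ _).trans (add_le_add (hC ⟨p, rfl⟩) (hD ⟨p, rfl⟩))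

/-- The maximal C⋆-seminorm on the algebraic tensor product of two unital C⋆-algebras. -/
def maxNorm (x : A ⊗[ℂ] B) : ℝ := ⨆ p : CStarSeminorm (A ⊗[ℂ] B), p x

lemma CStarSeminorm.le_maxNorm (p : CStarSeminorm (A ⊗[ℂ] B)) (x : A ⊗[ℂ] B) : p x ≤ maxNorm x :=
  le_ciSup (CStarSeminorm.bddAbove x) p

lemma maxNorm_le {x : A ⊗[ℂ] B} {c : ℝ} (h : ∀ p : CStarSeminorm (A ⊗[ℂ] B), p x ≤ c) :
    maxNorm x ≤ c := ciSup_le h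

lemma maxNorm_nonneg (x : A ⊗[ℂ] B) : 0 ≤ maxNorm x :=
  ((default : CStarSeminorm (A ⊗[ℂ] B)).nonneg x).trans (CStarSeminorm.le_maxNorm _ x)

variable (A B) in
/-- The maximal C⋆-seminorm as a bundled C⋆-seminorm. -/
def maxSeminorm : CStarSeminorm (A ⊗[ℂ] B) where
  toSeminorm := Seminorm.ofSMulLE maxNorm
    (le_antisymm (maxNorm_le fun p => (map_zero p.toSeminorm).le) (maxNorm_nonneg 0))
    (fun x y => maxNorm_le fun p => (map_add_le_add p.toSeminorm x y).trans
      (add_le_add (p.le_maxNorm x) (p.le_maxNorm y)))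
    (fun c x => maxNorm_le fun p => by
      rw [map_smul_eq_mul]
      exact mul_le_mul_of_nonneg_left (p.le_maxNorm x) (norm_nonneg c))
  mul_le' x y := maxNorm_le fun p => (p.mul_le x y).trans
    (mul_le_mul (p.le_maxNorm x) (p.le_maxNorm y) (p.nonneg y) (maxNorm_nonneg x))
  star_mul_self' x := by
    change maxNorm (star x * x) = maxNorm x ^ 2
    apply le_antisymm
    · refine maxNorm_le fun p => ?_
      rw [p.star_mul_self]
      exact pow_le_pow_left₀ (p.nonneg x) (p.le_maxNorm x) 2
    · have h : maxNorm x ≤ √(maxNorm (star x * x)) := maxNorm_le fun p => by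
        refine Real.le_sqrt_of_sq_le ?_
        rw [← p.star_mul_self]
        exact p.le_maxNorm _
      calc maxNorm x ^ 2 ≤ √(maxNorm (star x * x)) ^ 2 :=
            pow_le_pow_left₀ (maxNorm_nonneg x) h 2
        _ = _ := Real.sq_sqrt (maxNorm_nonneg _)

variable (A B) in
/-- The algebraic tensor product, equipped with the maximal C⋆-seminorm. -/
def PreCStarTensor : Type _ := A ⊗[ℂ] B

namespace PreCStarTensor

instance : Ring (PreCStarTensor A B) := inferInstanceAs (Ring (A ⊗[ℂ] B))
instance : StarRing (PreCStarTensor A B) := inferInstanceAs (StarRing (A ⊗[ℂ] B))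
instance : Algebra ℂ (PreCStarTensor A B) := inferInstanceAs (Algebra ℂ (A ⊗[ℂ] B))
instance : StarModule ℂ (PreCStarTensor A B) := inferInstanceAs (StarModule ℂ (A ⊗[ℂ] B))

instance : SeminormedRing (PreCStarTensor A B) where
  __ := (inferInstance : Ring (PreCStarTensor A B))
  toPseudoMetricSpace := (show SeminormedAddCommGroup (PreCStarTensor A B) from
    (maxSeminorm A B).toSeminorm.toAddGroupSeminorm.toSeminormedAddCommGroup).toPseudoMetricSpace
  norm := maxSeminorm A B
  dist_eq x y := (show SeminormedAddCommGroup (PreCStarTensor A B) from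
    (maxSeminorm A B).toSeminorm.toAddGroupSeminorm.toSeminormedAddCommGroup).dist_eq x y
  norm_mul_le x y := (maxSeminorm A B).mul_le x y

instance : NormedAlgebra ℂ (PreCStarTensor A B) where
  __ := (inferInstance : Algebra ℂ (PreCStarTensor A B))
  norm_smul_le c x := (map_smul_eq_mul (maxSeminorm A B).toSeminorm c x).le

lemma norm_def (x : PreCStarTensor A B) : ‖x‖ = maxNorm (show A ⊗[ℂ] B from x) := rfl

lemma norm_star (x : PreCStarTensor A B) : ‖star x‖ = ‖x‖ := (maxSeminorm A B).map_star x

lemma norm_star_mul_self (x : PreCStarTensor A B) : ‖star x * x‖ = ‖x‖ * ‖x‖ :=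
  ((maxSeminorm A B).star_mul_self x).trans (sq _)

lemma uniformContinuous_star : UniformContinuous (star : PreCStarTensor A B → PreCStarTensor A B) := by
  refine Isometry.uniformContinuous (Isometry.of_dist_eq fun x y => ?_)
  rw [dist_eq_norm, dist_eq_norm, ← star_sub (R := PreCStarTensor A B), norm_star]

end PreCStarTensor

variable (A B) in
/-- The (maximal) C⋆-tensor product. -/
def CStarTensor : Type _ := UniformSpace.Completion (PreCStarTensor A B)

namespace CStarTensor
open UniformSpace

instance : NormedRing (CStarTensor A B) :=
  inferInstanceAs (NormedRing (Completion (PreCStarTensor A B)))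
instance : CompleteSpace (CStarTensor A B) :=
  inferInstanceAs (CompleteSpace (Completion (PreCStarTensor A B)))

instance : NormedAlgebra ℂ (CStarTensor A B) where
  __ := (inferInstance : Algebra ℂ (Completion (PreCStarTensor A B)))
  norm_smul_le c x := norm_smul_le c (show Completion (PreCStarTensor A B) from x)

/-- The canonical map from the algebraic tensor product, as a linear map. -/
def coeL : PreCStarTensor A B →ₗ[ℂ] CStarTensor A B :=
  (Completion.toComplₗᵢ (𝕜 := ℂ) (E := PreCStarTensor A B)).toLinearMap

lemma denseRange_coeL : DenseRange (coeL : PreCStarTensor A B → CStarTensor A B) :=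
  Completion.denseRange_coe

lemma norm_coeL (x : PreCStarTensor A B) : ‖coeL x‖ = ‖x‖ := Completion.norm_coe x

lemma coeL_mul (x y : PreCStarTensor A B) : coeL (x * y) = coeL x * coeL y := Completion.coe_mul x y

instance : Star (CStarTensor A B) :=
  ⟨(Completion.map star : Completion (PreCStarTensor A B) → Completion (PreCStarTensor A B))⟩

lemma continuous_star : Continuous (star : CStarTensor A B → CStarTensor A B) :=
  Completion.continuous_map

lemma star_coeL (x : PreCStarTensor A B) : star (coeL x) = coeL (star x) :=
  Completion.map_coe PreCStarTensor.uniformContinuous_star x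

instance : StarRing (CStarTensor A B) where
  star_involutive x := by
    refine denseRange_coeL.induction_on x (isClosed_eq (continuous_star.comp continuous_star) continuous_id) fun y => ?_
    rw [star_coeL, star_coeL, star_star]
  star_mul x y := by
    refine denseRange_coeL.induction_on₂ (p := fun x y => star (x * y) = star y * star x) ?_ ?_ x y
    · exact isClosed_eq (continuous_star.comp continuous_mul)
        ((continuous_star.comp continuous_snd).mul (continuous_star.comp continuous_fst))
    · intro x y
      rw [← coeL_mul, star_coeL, star_coeL, star_coeL, star_mul, coeL_mul]
  star_add x y := by
    refine denseRange_coeL.induction_on₂ (p := fun x y => star (x + y) = star x + star y) ?_ ?_ x y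
    · exact isClosed_eq (continuous_star.comp continuous_add)
        ((continuous_star.comp continuous_fst).add (continuous_star.comp continuous_snd))
    · intro x y
      rw [← map_add, star_coeL, star_coeL, star_coeL, star_add, map_add]

instance : CStarAlgebra (CStarTensor A B) where
  norm_mul_self_le x := by
    refine denseRange_coeL.induction_on (p := fun x => ‖x‖ * ‖x‖ ≤ ‖star x * x‖) x ?_ fun y => ?_
    · exact isClosed_le (continuous_norm.mul continuous_norm)
        (continuous_norm.comp (continuous_star.mul continuous_id))
    · rw [star_coeL, ← coeL_mul, norm_coeL, norm_coeL, PreCStarTensor.norm_star_mul_self]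
  star_smul c x := by
    refine denseRange_coeL.induction_on (p := fun x => star (c • x) = star c • star x) x ?_ fun y => ?_
    · exact isClosed_eq (continuous_star.comp (continuous_const_smul c)) ((continuous_const_smul (star c)).comp continuous_star)
    · rw [← map_smul, star_coeL, star_coeL, star_smul, map_smul]

variable (A B) in
/-- The canonical ⋆-homomorphism from the algebraic tensor product to the C⋆-tensor product. -/
def of : A ⊗[ℂ] B →⋆ₐ[ℂ] CStarTensor A B where
  toFun x := coeL (A := A) (B := B) x
  map_one' := Completion.coe_one _
  map_mul' := coeL_mul
  map_zero' := map_zero coeL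
  map_add' := map_add coeL
  commutes' c := by
    rw [Algebra.algebraMap_eq_smul_one, Algebra.algebraMap_eq_smul_one]
    exact (map_smul coeL c _).trans (congrArg _ (Completion.coe_one _))
  map_star' x := (star_coeL x).symm

lemma denseRange_of : DenseRange (of A B) := denseRange_coeL

lemma norm_of (x : A ⊗[ℂ] B) : ‖of A B x‖ = maxNorm x := norm_coeL x

section Lift
variable {C : Type*} [CStarAlgebra C]

/-- The continuous extension to the C⋆-tensor product of a linear map on the algebraic tensor
product that is bounded for the maximal C⋆-seminorm. -/
def extend {E : Type*} [NormedAddCommGroup E] [NormedSpace ℂ E] [CompleteSpace E]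
    (T : A ⊗[ℂ] B →ₗ[ℂ] E) (_hT : ∀ x, ‖T x‖ ≤ maxNorm x) : CStarTensor A B →L[ℂ] E :=
  T.extendOfNorm (of A B).toAlgHom.toLinearMap

@[simp] lemma extend_of {E : Type*} [NormedAddCommGroup E] [NormedSpace ℂ E] [CompleteSpace E]
    (T : A ⊗[ℂ] B →ₗ[ℂ] E) (hT : ∀ x, ‖T x‖ ≤ maxNorm x) (x : A ⊗[ℂ] B) :
    extend T hT (of A B x) = T x :=
  LinearMap.extendOfNorm_eq (e := (of A B).toAlgHom.toLinearMap) denseRange_of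
    ⟨1, fun x => by rw [one_mul]; exact (hT x).trans_eq (norm_of x).symm⟩ x

/-- The extension of a ⋆-homomorphism from the algebraic tensor product into a C⋆-algebra. -/
def lift (π : A ⊗[ℂ] B →⋆ₐ[ℂ] C) : CStarTensor A B →⋆ₐ[ℂ] C :=
  let T := extend π.toAlgHom.toLinearMap fun x => (CStarSeminorm.ofHom π).le_maxNorm x
  have hT : ∀ x, T (of A B x) = π x := fun x => extend_of _ _ x
  have h1 : T 1 = 1 := by rw [← map_one (of A B), hT, map_one]
  { toFun := T
    map_one' := h1
    map_mul' := fun x y => by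
      refine denseRange_of.induction_on₂ (p := fun x y => T (x * y) = T x * T y) ?_ ?_ x y
      · exact isClosed_eq (T.continuous.comp continuous_mul)
          ((T.continuous.comp continuous_fst).mul (T.continuous.comp continuous_snd))
      · intro x y
        rw [← map_mul, hT, hT, hT, map_mul]
    map_zero' := map_zero T
    map_add' := map_add T
    commutes' := fun c => by
      rw [Algebra.algebraMap_eq_smul_one, Algebra.algebraMap_eq_smul_one, map_smul, h1]
    map_star' := fun x => by
      refine denseRange_of.induction_on (p := fun x => T (star x) = star (T x)) x ?_ fun y => ?_
      · exact isClosed_eq (T.continuous.comp ContinuousStar.continuous_star)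
          (ContinuousStar.continuous_star.comp T.continuous)
      · rw [← StarHomClass.map_star, hT, hT, StarHomClass.map_star] }

@[simp] lemma lift_of (π : A ⊗[ℂ] B →⋆ₐ[ℂ] C) (x : A ⊗[ℂ] B) : lift π (of A B x) = π x :=
  extend_of π.toAlgHom.toLinearMap (fun x => (CStarSeminorm.ofHom π).le_maxNorm x) x

/-- The ⋆-homomorphism `a ⊗ b ↦ φ a * ψ b` determined by a commuting pair of
⋆-homomorphisms. -/
def liftPair (φ : A →⋆ₐ[ℂ] C) (ψ : B →⋆ₐ[ℂ] C) (h : ∀ a b, Commute (φ a) (ψ b)) :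
    CStarTensor A B →⋆ₐ[ℂ] C :=
  lift
    { __ := Algebra.TensorProduct.lift φ.toAlgHom ψ.toAlgHom h
      map_star' := fun x => by
        change Algebra.TensorProduct.lift φ.toAlgHom ψ.toAlgHom h (star x) =
          star (Algebra.TensorProduct.lift φ.toAlgHom ψ.toAlgHom h x)
        induction x with
        | zero => simp
        | tmul a b =>
          simp only [TensorProduct.star_tmul, Algebra.TensorProduct.lift_tmul, star_mul]
          change φ (star a) * ψ (star b) = star (ψ b) * star (φ a)
          rw [← StarHomClass.map_star, ← StarHomClass.map_star]
          exact h _ _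
        | add x y hx hy => rw [star_add, map_add, map_add, star_add, hx, hy] }

@[simp] lemma liftPair_tmul (φ : A →⋆ₐ[ℂ] C) (ψ : B →⋆ₐ[ℂ] C) (h : ∀ a b, Commute (φ a) (ψ b))
    (a : A) (b : B) : liftPair φ ψ h (of A B (a ⊗ₜ b)) = φ a * ψ b :=
  lift_of _ _

end Lift

variable (A B) in
/-- The embedding `a ↦ a ⊗ 1`. -/
def inl : A →⋆ₐ[ℂ] CStarTensor A B := (of A B).comp (algInl A B)

variable (A B) in
/-- The embedding `b ↦ 1 ⊗ b`. -/
def inr : B →⋆ₐ[ℂ] CStarTensor A B := (of A B).comp (algInr A B)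

lemma commute_inl_inr (a : A) (b : B) : Commute (inl A B a) (inr A B b) := by
  change of A B (a ⊗ₜ 1) * of A B (1 ⊗ₜ b) = of A B (1 ⊗ₜ b) * of A B (a ⊗ₜ 1)
  rw [← map_mul, ← map_mul]
  simp

/-- The tensor product `φ ⊗ ψ` of two ⋆-homomorphisms. -/
def map {C D : Type*} [CStarAlgebra C] [CStarAlgebra D] (φ : A →⋆ₐ[ℂ] C) (ψ : B →⋆ₐ[ℂ] D) :
    CStarTensor A B →⋆ₐ[ℂ] CStarTensor C D :=
  liftPair ((inl C D).comp φ) ((inr C D).comp ψ) fun a b => by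
    rw [StarAlgHom.comp_apply, StarAlgHom.comp_apply]; exact commute_inl_inr (φ a) (ψ b)

lemma map_tmul {C D : Type*} [CStarAlgebra C] [CStarAlgebra D] (φ : A →⋆ₐ[ℂ] C) (ψ : B →⋆ₐ[ℂ] D)
    (a : A) (b : B) : map φ ψ (of A B (a ⊗ₜ b)) = of C D (φ a ⊗ₜ ψ b) := by
  rw [map, liftPair_tmul]
  change of C D (φ a ⊗ₜ 1) * of C D (1 ⊗ₜ ψ b) = _
  rw [← map_mul]
  simp

open scoped CStarAlgebra in
/-- The associativity map `(a ⊗ b) ⊗ c ↦ a ⊗ (b ⊗ c)`. -/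
def assoc (A B C : Type*) [CStarAlgebra A] [CStarAlgebra B] [CStarAlgebra C] :
    CStarTensor (CStarTensor A B) C →⋆ₐ[ℂ] CStarTensor A (CStarTensor B C) :=
  liftPair (map (StarAlgHom.id ℂ A) (inl B C)) ((inr A (CStarTensor B C)).comp (inr B C)) <| by
    intro x c
    set T := map (StarAlgHom.id ℂ A) (inl B C) with hT
    refine denseRange_of.induction_on
      (p := fun x => T x * inr A _ (inr B C c) = inr A _ (inr B C c) * T x) x ?_ fun y => ?_
    · have hc : Continuous T := map_continuous T
      exact isClosed_eq (hc.mul continuous_const) (continuous_const.mul hc)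
    · induction y with
      | zero => simp
      | tmul a b =>
        rw [hT, map_tmul]
        change of _ _ (a ⊗ₜ inl B C b) * of _ _ (1 ⊗ₜ inr B C c) =
          of _ _ (1 ⊗ₜ inr B C c) * of _ _ (a ⊗ₜ inl B C b)
        rw [← map_mul, ← map_mul]
        simp [(commute_inl_inr b c).eq]
      | add x y hx hy => rw [map_add, map_add, add_mul, mul_add, hx, hy]

lemma assoc_tmul {C : Type*} [CStarAlgebra C] (a : A) (b : B) (c : C) :
    assoc A B C (of _ C (of A B (a ⊗ₜ b) ⊗ₜ c)) = of A _ (a ⊗ₜ of B C (b ⊗ₜ c)) := by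
  rw [assoc, liftPair_tmul, map_tmul]
  change of _ _ (a ⊗ₜ of B C (b ⊗ₜ 1)) * of _ _ (1 ⊗ₜ of B C (1 ⊗ₜ c)) = _
  rw [← map_mul, Algebra.TensorProduct.tmul_mul_tmul, mul_one, ← map_mul]
  simp

end CStarTensor
end Tensor

/-- A state on a unital C⋆-algebra. -/
structure CStarState (A : Type*) [CStarAlgebra A] extends A →ₗ[ℂ] ℂ where
  nonneg' : ∀ a, 0 ≤ toFun (star a * a)
  map_one' : toFun 1 = 1

namespace CStarState
variable {A B : Type*} [CStarAlgebra A] [CStarAlgebra B]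

instance : CoeFun (CStarState A) (fun _ => A → ℂ) := ⟨fun f => f.toLinearMap⟩

/-- A state is faithful if it vanishes at no nonzero positive element. -/
def IsFaithful (f : CStarState A) : Prop := ∀ a, f (star a * a) = 0 → a = 0

lemma nonneg (f : CStarState A) (a : A) : 0 ≤ f (star a * a) := f.nonneg' a

lemma map_one (f : CStarState A) : f 1 = 1 := f.map_one'

/-- A state as a bundled positive linear map. -/
def toPLM [PartialOrder A] [StarOrderedRing A] (f : CStarState A) : A →ₚ[ℂ] ℂ :=
  PositiveLinearMap.mk₀ f.toLinearMap fun a ha => by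
    obtain ⟨b, rfl⟩ := CStarAlgebra.nonneg_iff_eq_star_mul_self.mp ha
    exact f.nonneg b

lemma map_star (f : CStarState A) (a : A) : f (star a) = star (f a) := by
  let _ := CStarAlgebra.spectralOrder A
  let _ := CStarAlgebra.spectralOrderedRing A
  exact StarHomClass.map_star f.toPLM a

/-- A norm-one functional with value one at the unit is a state. -/
def ofNormOne (g : StrongDual ℂ A) (hg : ‖g‖ ≤ 1) (h1 : g 1 = 1) : CStarState A where
  toLinearMap := g.toLinearMap
  map_one' := h1
  nonneg' a := by
    have : Nontrivial A := by
      by_contra h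
      rw [not_nontrivial_iff_subsingleton] at h
      have : (1 : A) = 0 := Subsingleton.elim _ _
      rw [this, map_zero] at h1
      exact zero_ne_one h1
    let _ := CStarAlgebra.spectralOrder A
    let _ := CStarAlgebra.spectralOrderedRing A
    set h := star a * a with hh
    have hpos : 0 ≤ h := star_mul_self_nonneg a
    have hsa : star h = h := (IsSelfAdjoint.star_mul_self a).star_eq
    have hbd : ∀ x, ‖g x‖ ≤ ‖x‖ := fun x => (g.le_opNorm x).trans
      (mul_le_of_le_one_left (norm_nonneg x) hg)
    change 0 ≤ g h
    have him : (g h).im = 0 := by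
      have key : ∀ t : ℝ, 2 * (g h).im * t ≤ ‖h‖ ^ 2 := by
        intro t
        have e1 : ‖h + ((t : ℂ) * Complex.I) • (1 : A)‖ ^ 2 ≤ ‖h‖ ^ 2 + t ^ 2 := by
          rw [sq, ← CStarRing.norm_star_mul_self]
          have : star (h + ((t : ℂ) * Complex.I) • (1 : A)) * (h + ((t : ℂ) * Complex.I) • (1 : A))
              = h * h + ((t ^ 2 : ℝ) : ℂ) • (1 : A) := by
            simp only [star_add, star_smul, star_one, hsa, add_mul, mul_add, smul_mul_assoc,
              mul_smul_comm, one_mul, mul_one, star_mul', Complex.star_def,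
              Complex.conj_ofReal, Complex.conj_I]
            have hI : (t : ℂ) * Complex.I * (t * -Complex.I) = ((t ^ 2 : ℝ) : ℂ) := by
              push_cast
              linear_combination (-(t : ℂ) ^ 2) * Complex.I_sq
            rw [smul_add, smul_smul, hI]
            module
          rw [this]
          refine (norm_add_le _ _).trans (add_le_add ((norm_mul_le _ _).trans_eq (sq _).symm) ?_)
          rw [norm_smul, norm_one, mul_one, Complex.norm_real, Real.norm_of_nonneg (sq_nonneg t)]
        have e2 : ‖g (h + ((t : ℂ) * Complex.I) • (1 : A))‖ ^ 2 ≤ ‖h‖ ^ 2 + t ^ 2 :=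
          (pow_le_pow_left₀ (norm_nonneg _) (hbd _) 2).trans e1
        rw [map_add, map_smul, h1, ← Complex.normSq_eq_norm_sq, Complex.normSq_apply] at e2
        simp at e2
        nlinarith [sq_nonneg (g h).re, sq_nonneg (g h).im]
      by_contra hne
      have := key ((‖h‖ ^ 2 + 1) / (2 * (g h).im))
      have h3 : 2 * (g h).im * ((‖h‖ ^ 2 + 1) / (2 * (g h).im)) = ‖h‖ ^ 2 + 1 := by
        field_simp
      linarith
    have hre : 0 ≤ (g h).re := by
      have h2 : ‖((‖h‖ : ℂ)) • (1 : A) - h‖ ≤ ‖h‖ := by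
        refine (CStarAlgebra.norm_le_norm_of_nonneg_of_le (b := algebraMap ℝ A ‖h‖) ?_ ?_).trans ?_
        · rw [sub_nonneg, Complex.coe_smul, ← Algebra.algebraMap_eq_smul_one]
          exact IsSelfAdjoint.le_algebraMap_norm_self (IsSelfAdjoint.of_nonneg hpos)
        · rw [Complex.coe_smul, ← Algebra.algebraMap_eq_smul_one]
          exact sub_le_self _ hpos
        · simp
      have h3 := (Complex.abs_re_le_norm _).trans ((hbd _).trans h2)
      rw [map_sub, map_smul, h1] at h3
      simp at h3
      linarith [(abs_le.1 h3).2]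
    exact Complex.nonneg_iff.2 ⟨hre, him.symm⟩

lemma exists_norming (a : A) (ha : a ≠ 0) :
    ∃ f : CStarState A, f (star a * a) = (‖a‖ ^ 2 : ℝ) := by
  have : Nontrivial A := ⟨a, 0, ha⟩
  let _ := CStarAlgebra.spectralOrder A
  let _ := CStarAlgebra.spectralOrderedRing A
  set h := star a * a with hh
  have hn : ‖h‖ = ‖a‖ ^ 2 := by rw [hh, CStarRing.norm_star_mul_self, sq]
  have hpos : 0 ≤ h := star_mul_self_nonneg a
  have h1 : ‖1 + h‖ = 1 + ‖h‖ := by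
    apply le_antisymm
    · exact (norm_add_le _ _).trans_eq (by rw [norm_one])
    · have hs : ‖h‖ ∈ spectrum ℝ h := CStarAlgebra.norm_mem_spectrum_of_nonneg hpos
      have hs2 : 1 + ‖h‖ ∈ spectrum ℝ (1 + h) := by
        have := (spectrum.add_mem_add_iff (R := ℝ) (a := h) (r := ‖h‖) (s := 1)).2 hs
        rw [_root_.map_one] at this
        rwa [add_comm ‖h‖ 1] at this
      have := spectrum.norm_le_norm_of_mem hs2
      rwa [Real.norm_of_nonneg (by positivity)] at this
  obtain ⟨g, hg, hgx⟩ := exists_dual_vector'' ℂ (1 + h)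
  have hb : ∀ x, ‖g x‖ ≤ ‖x‖ := fun x => (g.le_opNorm x).trans
    (mul_le_of_le_one_left (norm_nonneg x) hg)
  have hb1 := hb 1
  rw [norm_one] at hb1
  have hbh := hb h
  rw [h1, map_add] at hgx
  have hre := congrArg Complex.re hgx
  have him := congrArg Complex.im hgx
  simp at hre him
  have r1 := (Complex.re_le_norm (g 1)).trans hb1
  have r2 := (Complex.re_le_norm (g h)).trans hbh
  have g1 : g 1 = 1 := by
    have hr : (g 1).re = 1 := by linarith
    have : (g 1).im = 0 := by
      have h5 : ‖g 1‖ ^ 2 ≤ 1 := by nlinarith [norm_nonneg (g 1)]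
      rw [← Complex.normSq_eq_norm_sq, Complex.normSq_apply, hr] at h5
      nlinarith
    exact Complex.ext (by simpa using hr) (by simpa using this)
  refine ⟨ofNormOne g hg g1, ?_⟩
  change g h = _
  rw [g1] at hgx
  rw [← hn]
  push_cast at hgx
  exact add_left_cancel hgx

end CStarState

/-- The C⋆-seminorm `x ↦ ‖π x‖` of a ⋆-representation `π` on an inner product space. -/
def CStarSeminorm.ofRep {R E : Type*} [Ring R] [StarRing R] [Algebra ℂ R] [NormedAddCommGroup E]
    [InnerProductSpace ℂ E] (π : R →ₐ[ℂ] (E →L[ℂ] E))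
    (h : ∀ x u v, @inner ℂ E InnerProductSpace.toInner (π (star x) u) v =
      @inner ℂ E InnerProductSpace.toInner u (π x v)) : CStarSeminorm R where
  toFun x := ‖π x‖
  map_zero' := by simp
  add_le' x y := by rw [map_add]; exact norm_add_le _ _
  neg' x := by simp
  smul' c x := by rw [map_smul, norm_smul]
  mul_le' x y := by rw [map_mul]; exact norm_mul_le _ _
  star_mul_self' x := by
    have h1 : ‖π (star x)‖ ≤ ‖π x‖ := by
      refine ContinuousLinearMap.opNorm_le_bound _ (norm_nonneg _) fun u => ?_
      have h2 : ‖π (star x) u‖ * ‖π (star x) u‖ ≤ (‖π x‖ * ‖u‖) * ‖π (star x) u‖ := by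
        rw [← inner_self_eq_norm_mul_norm (𝕜 := ℂ), h]
        refine (RCLike.re_le_norm _).trans ((norm_inner_le_norm _ _).trans ?_)
        have := (π x).le_opNorm (π (star x) u)
        nlinarith [norm_nonneg u]
      rcases (norm_nonneg (π (star x) u)).eq_or_lt with h0 | h0
      · rw [← h0]; positivity
      · exact le_of_mul_le_mul_right h2 h0
    apply le_antisymm
    · rw [map_mul, sq]
      exact (norm_mul_le _ _).trans (mul_le_mul_of_nonneg_right h1 (norm_nonneg _))
    · have h2 : ‖π x‖ ≤ √‖π (star x * x)‖ := by
        refine ContinuousLinearMap.opNorm_le_bound _ (Real.sqrt_nonneg _) fun u => ?_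
        have h3 : ‖π x u‖ ^ 2 ≤ ‖π (star x * x)‖ * ‖u‖ ^ 2 := by
          rw [sq, ← inner_self_eq_norm_mul_norm (𝕜 := ℂ), ← h, map_mul]
          refine (RCLike.re_le_norm _).trans ((norm_inner_le_norm _ _).trans ?_)
          have := (π (star x) * π x).le_opNorm u
          rw [mul_apply_eq_comp] at this
          nlinarith [norm_nonneg u]
        rw [← Real.sqrt_sq (norm_nonneg u), ← Real.sqrt_mul (norm_nonneg _)]
        exact Real.le_sqrt_of_sq_le h3
      calc ‖π x‖ ^ 2 ≤ √‖π (star x * x)‖ ^ 2 := pow_le_pow_left₀ (norm_nonneg _) h2 2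
        _ = _ := Real.sq_sqrt (norm_nonneg _)

lemma inner_self_ofReal {E : Type*} [NormedAddCommGroup E] [InnerProductSpace ℂ E] (v : E) :
    @inner ℂ E InnerProductSpace.toInner v v = ((‖v‖ ^ 2 : ℝ) : ℂ) := by
  rw [inner_self_eq_norm_sq_to_K]
  push_cast
  rfl

section ProductRep
variable {A B : Type*} [CStarAlgebra A] [CStarAlgebra B]

section
variable [PartialOrder A] [StarOrderedRing A]
  [PartialOrder B] [StarOrderedRing B]

/-- The tensor product of two GNS representations. -/
def prodRep (f : A →ₚ[ℂ] ℂ) (g : B →ₚ[ℂ] ℂ) :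
    A ⊗[ℂ] B →ₐ[ℂ] (f.GNS ⊗[ℂ] g.GNS →L[ℂ] f.GNS ⊗[ℂ] g.GNS) :=
  Algebra.TensorProduct.lift
    (AlgHom.ofLinearMap
      { toFun := fun a => TensorProduct.mapL (f.gnsStarAlgHom a) (1 : g.GNS →L[ℂ] g.GNS)
        map_add' := fun a b => by rw [map_add, TensorProduct.mapL_add_left]
        map_smul' := fun c a => by rw [map_smul, TensorProduct.mapL_smul_left]; rfl }
      (by change TensorProduct.mapL (f.gnsStarAlgHom 1) 1 = 1
          rw [map_one]; exact TensorProduct.mapL_id_id)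
      (fun a b => by
        change TensorProduct.mapL (f.gnsStarAlgHom (a * b)) 1 =
          TensorProduct.mapL (f.gnsStarAlgHom a) 1 * TensorProduct.mapL (f.gnsStarAlgHom b) 1
        rw [← TensorProduct.mapL_mul, map_mul, one_mul]))
    (AlgHom.ofLinearMap
      { toFun := fun b => TensorProduct.mapL (1 : f.GNS →L[ℂ] f.GNS) (g.gnsStarAlgHom b)
        map_add' := fun a b => by rw [map_add, TensorProduct.mapL_add_right]
        map_smul' := fun c a => by rw [map_smul, TensorProduct.mapL_smul_right]; rfl }
      (by change TensorProduct.mapL 1 (g.gnsStarAlgHom 1) = 1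
          rw [map_one]; exact TensorProduct.mapL_id_id)
      (fun a b => by
        change TensorProduct.mapL 1 (g.gnsStarAlgHom (a * b)) =
          TensorProduct.mapL 1 (g.gnsStarAlgHom a) * TensorProduct.mapL 1 (g.gnsStarAlgHom b)
        rw [← TensorProduct.mapL_mul, map_mul, one_mul]))
    (fun a b => by
      change TensorProduct.mapL (f.gnsStarAlgHom a) 1 * TensorProduct.mapL 1 (g.gnsStarAlgHom b) =
        TensorProduct.mapL 1 (g.gnsStarAlgHom b) * TensorProduct.mapL (f.gnsStarAlgHom a) 1
      rw [← TensorProduct.mapL_mul, ← TensorProduct.mapL_mul, one_mul, mul_one, one_mul, mul_one])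

lemma prodRep_tmul (f : A →ₚ[ℂ] ℂ) (g : B →ₚ[ℂ] ℂ) (a : A) (b : B) (u : f.GNS) (v : g.GNS) :
    prodRep f g (a ⊗ₜ b) (u ⊗ₜ v) = (f.gnsStarAlgHom a u) ⊗ₜ (g.gnsStarAlgHom b v) := by
  rw [prodRep, Algebra.TensorProduct.lift_tmul]
  change TensorProduct.mapL (f.gnsStarAlgHom a) (1 : g.GNS →L[ℂ] g.GNS)
    (TensorProduct.mapL (1 : f.GNS →L[ℂ] f.GNS) (g.gnsStarAlgHom b) (u ⊗ₜ v)) = _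
  rw [TensorProduct.mapL_tmul, TensorProduct.mapL_tmul]
  rfl

lemma prodRep_star (f : A →ₚ[ℂ] ℂ) (g : B →ₚ[ℂ] ℂ) (x : A ⊗[ℂ] B) (u v : f.GNS ⊗[ℂ] g.GNS) :
    ⟪prodRep f g (star x) u, v⟫_ℂ = ⟪u, prodRep f g x v⟫_ℂ := by
  induction x with
  | zero => simp
  | add x y hx hy =>
    rw [star_add, map_add, map_add, add_apply, add_apply,
      inner_add_left, inner_add_right, hx, hy]
  | tmul a b =>
    induction u with
    | zero => simp
    | add x y hx hy => rw [map_add, inner_add_left, inner_add_left, hx, hy]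
    | tmul p q =>
      induction v with
      | zero => simp
      | add x y hx hy => rw [map_add, inner_add_right, inner_add_right, hx, hy]
      | tmul r s =>
        rw [TensorProduct.star_tmul, prodRep_tmul, prodRep_tmul, TensorProduct.inner_tmul,
          TensorProduct.inner_tmul, StarHomClass.map_star, StarHomClass.map_star,
          ContinuousLinearMap.star_eq_adjoint, ContinuousLinearMap.star_eq_adjoint,
          ContinuousLinearMap.adjoint_inner_left, ContinuousLinearMap.adjoint_inner_left]

lemma prodRep_le (f : A →ₚ[ℂ] ℂ) (g : B →ₚ[ℂ] ℂ) (x : A ⊗[ℂ] B) : ‖prodRep f g x‖ ≤ maxNorm x :=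
  (CStarSeminorm.ofRep (prodRep f g) (prodRep_star f g)).le_maxNorm x

lemma inner_self_tensor (f : A →ₚ[ℂ] ℂ) (g : B →ₚ[ℂ] ℂ) (v : f.GNS ⊗[ℂ] g.GNS) :
    ⟪v, v⟫_ℂ = ((‖v‖ ^ 2 : ℝ) : ℂ) :=
  inner_self_ofReal (E := f.GNS ⊗[ℂ] g.GNS) v

/-- The cyclic vector of the tensor product of two GNS representations. -/
def prodVec (f : A →ₚ[ℂ] ℂ) (g : B →ₚ[ℂ] ℂ) : f.GNS ⊗[ℂ] g.GNS :=
  (f.toPreGNS 1 : f.GNS) ⊗ₜ (g.toPreGNS 1 : g.GNS)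

lemma inner_prodVec (f : A →ₚ[ℂ] ℂ) (g : B →ₚ[ℂ] ℂ) (a : A) (b : B) :
    ⟪prodVec f g, prodRep f g (a ⊗ₜ b) (prodVec f g)⟫_ℂ = f a * g b := by
  rw [prodVec, prodRep_tmul, TensorProduct.inner_tmul]
  congr 1 <;> simp [PositiveLinearMap.preGNS_inner_def]
end

namespace CStarState

/-- The functional `a ⊗ b ↦ f a * g b` on the algebraic tensor product. -/
def algProd (f : CStarState A) (g : CStarState B) : A ⊗[ℂ] B →ₗ[ℂ] ℂ :=
  LinearMap.mul' ℂ ℂ ∘ₗ TensorProduct.map f.toLinearMap g.toLinearMap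

lemma algProd_tmul (f : CStarState A) (g : CStarState B) (a : A) (b : B) :
    algProd f g (a ⊗ₜ b) = f a * g b := by simp [algProd]

lemma algProd_eq [PartialOrder A] [StarOrderedRing A] [PartialOrder B] [StarOrderedRing B]
    (f : CStarState A) (g : CStarState B) (x : A ⊗[ℂ] B) :
    algProd f g x =
      ⟪prodVec f.toPLM g.toPLM, prodRep f.toPLM g.toPLM x (prodVec f.toPLM g.toPLM)⟫_ℂ := by
  induction x with
  | zero => simp
  | add x y hx hy => rw [map_add, map_add, add_apply, inner_add_right, hx, hy]
  | tmul a b => rw [inner_prodVec, algProd_tmul]; rfl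

lemma algProd_one (f : CStarState A) (g : CStarState B) : algProd f g 1 = 1 := by
  rw [Algebra.TensorProduct.one_def, algProd_tmul, f.map_one, g.map_one, one_mul]

lemma norm_prodVec_sq [PartialOrder A] [StarOrderedRing A] [PartialOrder B] [StarOrderedRing B]
    (f : CStarState A) (g : CStarState B) : ‖prodVec f.toPLM g.toPLM‖ = 1 := by
  have h := algProd_eq f g 1
  rw [algProd_one, _root_.map_one, one_apply_eq_self] at h
  have h2 : ‖prodVec f.toPLM g.toPLM‖ ^ 2 = 1 := by
    exact_mod_cast (h.trans (inner_self_tensor _ _ _)).symm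
  exact (pow_eq_one_iff_of_nonneg (norm_nonneg _) two_ne_zero).1 h2

lemma algProd_star_mul [PartialOrder A] [StarOrderedRing A] [PartialOrder B] [StarOrderedRing B]
    (f : CStarState A) (g : CStarState B) (x y : A ⊗[ℂ] B) :
    algProd f g (star x * y) = ⟪prodRep f.toPLM g.toPLM x (prodVec f.toPLM g.toPLM),
      prodRep f.toPLM g.toPLM y (prodVec f.toPLM g.toPLM)⟫_ℂ := by
  rw [algProd_eq, map_mul, mul_apply_eq_comp, ← prodRep_star, star_star]

lemma algProd_nonneg (f : CStarState A) (g : CStarState B) (x : A ⊗[ℂ] B) :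
    0 ≤ algProd f g (star x * x) := by
  let _ := CStarAlgebra.spectralOrder A
  let _ := CStarAlgebra.spectralOrderedRing A
  let _ := CStarAlgebra.spectralOrder B
  let _ := CStarAlgebra.spectralOrderedRing B
  rw [algProd_star_mul]
  exact le_of_le_of_eq (Complex.zero_le_real.2 (sq_nonneg _)) (inner_self_tensor _ _ _).symm

lemma algProd_bound (f : CStarState A) (g : CStarState B) (x : A ⊗[ℂ] B) :
    ‖algProd f g x‖ ≤ maxNorm x := by
  let _ := CStarAlgebra.spectralOrder A
  let _ := CStarAlgebra.spectralOrderedRing A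
  let _ := CStarAlgebra.spectralOrder B
  let _ := CStarAlgebra.spectralOrderedRing B
  rw [algProd_eq]
  refine (norm_inner_le_norm (𝕜 := ℂ) (prodVec f.toPLM g.toPLM) _).trans ?_
  have h1 := (prodRep f.toPLM g.toPLM x).le_opNorm (prodVec f.toPLM g.toPLM)
  rw [norm_prodVec_sq, mul_one] at h1
  rw [norm_prodVec_sq, one_mul]
  exact h1.trans (prodRep_le _ _ x)

/-- The product state `f ⊗ g` on `A ⊗ B`, determined by `(f ⊗ g) (a ⊗ b) = f a * g b`. -/
def prod (f : CStarState A) (g : CStarState B) : CStarState (CStarTensor A B) where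
  toLinearMap := (CStarTensor.extend (algProd f g) (algProd_bound f g)).toLinearMap
  map_one' := by
    change CStarTensor.extend (algProd f g) (algProd_bound f g) 1 = 1
    rw [← _root_.map_one (CStarTensor.of A B), CStarTensor.extend_of, algProd_one]
  nonneg' x := by
    set T := CStarTensor.extend (algProd f g) (algProd_bound f g)
    refine CStarTensor.denseRange_of.induction_on (p := fun x => 0 ≤ T (star x * x)) x ?_ fun y => ?_
    · exact isClosed_Ici.preimage (T.continuous.comp (continuous_star.mul continuous_id))
    · rw [← StarHomClass.map_star, ← map_mul, CStarTensor.extend_of]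
      exact algProd_nonneg f g y

lemma prod_tmul (f : CStarState A) (g : CStarState B) (a : A) (b : B) :
    f.prod g (CStarTensor.of A B (a ⊗ₜ b)) = f a * g b :=
  (CStarTensor.extend_of _ (algProd_bound f g) _).trans (algProd_tmul f g a b)

/-- The functional slice `id ⊗ g` on the algebraic tensor product. -/
def algSliceRight (g : CStarState B) : A ⊗[ℂ] B →ₗ[ℂ] A :=
  (TensorProduct.rid ℂ A).toLinearMap ∘ₗ g.toLinearMap.lTensor A

/-- The functional slice `f ⊗ id` on the algebraic tensor product. -/
def algSliceLeft (f : CStarState A) : A ⊗[ℂ] B →ₗ[ℂ] B :=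
  (TensorProduct.lid ℂ B).toLinearMap ∘ₗ f.toLinearMap.rTensor B

lemma algProd_slice (φ : CStarState A) (g : CStarState B) (c : A) (x : A ⊗[ℂ] B) :
    φ (c * algSliceRight g x) = algProd φ g ((c ⊗ₜ 1) * x) := by
  induction x with
  | zero => simp
  | add x y hx hy => rw [map_add, mul_add, map_add, mul_add, map_add, hx, hy]
  | tmul a b =>
    rw [Algebra.TensorProduct.tmul_mul_tmul, algProd_tmul, one_mul]
    simp [algSliceRight, mul_comm]

lemma algProd_sliceLeft (f : CStarState A) (ψ : CStarState B) (c : B) (x : A ⊗[ℂ] B) :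
    ψ (c * algSliceLeft f x) = algProd f ψ ((1 ⊗ₜ c) * x) := by
  induction x with
  | zero => simp
  | add x y hx hy => rw [map_add, mul_add, map_add, mul_add, map_add, hx, hy]
  | tmul a b =>
    rw [Algebra.TensorProduct.tmul_mul_tmul, algProd_tmul, one_mul]
    simp [algSliceLeft]

lemma algProd_cauchy (f : CStarState A) (g : CStarState B) (x y : A ⊗[ℂ] B) (r : ℝ) (hr : 0 < r)
    (h : algProd f g (star x * x) = (r ^ 2 : ℝ)) (h2 : algProd f g (star x * y) = (r ^ 2 : ℝ)) :
    r ≤ maxNorm y := by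
  let _ := CStarAlgebra.spectralOrder A
  let _ := CStarAlgebra.spectralOrderedRing A
  let _ := CStarAlgebra.spectralOrder B
  let _ := CStarAlgebra.spectralOrderedRing B
  rw [algProd_star_mul] at h h2
  have h3 := norm_inner_le_norm (𝕜 := ℂ) (prodRep f.toPLM g.toPLM x (prodVec f.toPLM g.toPLM))
    (prodRep f.toPLM g.toPLM y (prodVec f.toPLM g.toPLM))
  rw [h2, Complex.norm_real, Real.norm_of_nonneg (sq_nonneg r)] at h3
  have h4 : ‖prodRep f.toPLM g.toPLM x (prodVec f.toPLM g.toPLM)‖ ^ 2 = r ^ 2 := by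
    exact_mod_cast (inner_self_tensor _ _ _).symm.trans h
  have h5 : ‖prodRep f.toPLM g.toPLM x (prodVec f.toPLM g.toPLM)‖ = r :=
    (sq_eq_sq₀ (norm_nonneg _) hr.le).1 h4
  have h6 := (prodRep f.toPLM g.toPLM y).le_opNorm (prodVec f.toPLM g.toPLM)
  rw [norm_prodVec_sq, mul_one] at h6
  have h7 := h6.trans (prodRep_le _ _ y)
  rw [h5, sq] at h3
  exact (le_of_mul_le_mul_left h3 hr).trans h7

lemma algSliceRight_bound (g : CStarState B) (x : A ⊗[ℂ] B) :
    ‖algSliceRight g x‖ ≤ maxNorm x := by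
  by_cases h : algSliceRight g x = 0
  · rw [h, norm_zero]; exact maxNorm_nonneg x
  obtain ⟨φ, hφ⟩ := exists_norming _ h
  set a := algSliceRight g x with ha
  refine algProd_cauchy φ g (a ⊗ₜ 1) x ‖a‖ (norm_pos_iff.2 h) ?_ ?_
  · rw [TensorProduct.star_tmul, Algebra.TensorProduct.tmul_mul_tmul, algProd_tmul, star_one,
      one_mul, g.map_one, mul_one, hφ]
  · rw [TensorProduct.star_tmul, star_one, ← algProd_slice, ← ha, hφ]

lemma algSliceLeft_bound (f : CStarState A) (x : A ⊗[ℂ] B) :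
    ‖algSliceLeft f x‖ ≤ maxNorm x := by
  by_cases h : algSliceLeft f x = 0
  · rw [h, norm_zero]; exact maxNorm_nonneg x
  obtain ⟨φ, hφ⟩ := exists_norming _ h
  set a := algSliceLeft f x with ha
  refine algProd_cauchy f φ (1 ⊗ₜ a) x ‖a‖ (norm_pos_iff.2 h) ?_ ?_
  · rw [TensorProduct.star_tmul, Algebra.TensorProduct.tmul_mul_tmul, algProd_tmul, star_one,
      one_mul, f.map_one, one_mul, hφ]
  · rw [TensorProduct.star_tmul, star_one, ← algProd_sliceLeft, ← ha, hφ]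

variable (A) in
/-- The slice map `id ⊗ g : A ⊗ B → A`, determined by `a ⊗ b ↦ g b • a`. -/
def sliceRight (g : CStarState B) : CStarTensor A B →L[ℂ] A :=
  CStarTensor.extend (algSliceRight g) (algSliceRight_bound g)

variable (B) in
/-- The slice map `f ⊗ id : A ⊗ B → B`, determined by `a ⊗ b ↦ f a • b`. -/
def sliceLeft (f : CStarState A) : CStarTensor A B →L[ℂ] B :=
  CStarTensor.extend (algSliceLeft f) (algSliceLeft_bound f)

lemma sliceRight_tmul (g : CStarState B) (a : A) (b : B) :
    sliceRight A g (CStarTensor.of A B (a ⊗ₜ b)) = g b • a := by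
  rw [sliceRight, CStarTensor.extend_of]; simp [algSliceRight]

lemma sliceLeft_tmul (f : CStarState A) (a : A) (b : B) :
    sliceLeft B f (CStarTensor.of A B (a ⊗ₜ b)) = f a • b := by
  rw [sliceLeft, CStarTensor.extend_of]; simp [algSliceLeft]

end CStarState
end ProductRep

/-- A positive semidefinite sesquilinear form on a complex vector space `E` with values in a
C⋆-algebra `C`, conjugate linear in the first variable. -/
structure CStarInner (C E : Type*) [CStarAlgebra C] [AddCommGroup E] [Module ℂ E] where
  form : E → E → C
  star_form : ∀ x y, star (form x y) = form y x
  add_left : ∀ x y z, form (x + y) z = form x z + form y z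
  smul_left : ∀ (c : ℂ) x y, form (c • x) y = star c • form x y
  nonneg : ∀ x, ∃ c, form x x = star c * c

section Enveloping
variable {C E : Type*} [CStarAlgebra C] [AddCommGroup E] [Module ℂ E]

/-- The space `E` with the scalar inner product `g ⟨x, y⟩`. -/
def PreEnveloping (_I : CStarInner C E) (_g : CStarState C) : Type _ := E

namespace PreEnveloping
variable (I : CStarInner C E) (g : CStarState C)

instance : AddCommGroup (PreEnveloping I g) := inferInstanceAs (AddCommGroup E)
instance : Module ℂ (PreEnveloping I g) := inferInstanceAs (Module ℂ E)
/-- The scalar inner product `g ⟨x, y⟩` obtained from a C⋆-valued inner product and a state. -/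
abbrev core : PreInnerProductSpace.Core ℂ (PreEnveloping I g) where
  inner x y := g (I.form (show E from x) (show E from y))
  conj_inner_symm x y := by
    exact (g.map_star _).symm.trans (congrArg g (I.star_form (show E from y) (show E from x)))
  re_inner_nonneg x := by
    obtain ⟨c, hc⟩ := I.nonneg (show E from x)
    change 0 ≤ (g (I.form (show E from x) (show E from x))).re
    rw [hc]
    exact (Complex.nonneg_iff.1 (g.nonneg c)).1
  add_left x y z := by
    exact (congrArg g (I.add_left (show E from x) (show E from y) (show E from z))).trans
      (map_add g.toLinearMap _ _)
  smul_left x y c := by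
    exact (congrArg g (I.smul_left c (show E from x) (show E from y))).trans
      (map_smul g.toLinearMap _ _)

instance : SeminormedAddCommGroup (PreEnveloping I g) :=
  InnerProductSpace.Core.toSeminormedAddCommGroup (c := core I g)
instance : InnerProductSpace ℂ (PreEnveloping I g) :=
  InnerProductSpace.ofCore (core I g)

end PreEnveloping

/-- The enveloping Hilbert space of a (pre-)Hilbert module `E` over `C` with respect to a state `g`:
the completion of `E` for the inner product `g ⟨x, y⟩`. -/
abbrev EnvelopingSpace (I : CStarInner C E) (g : CStarState C) : Type _ :=
  UniformSpace.Completion (PreEnveloping I g)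

/-- The canonical map from a (pre-)Hilbert module to its enveloping Hilbert space. -/
def CStarInner.toEnveloping (I : CStarInner C E) (g : CStarState C) :
    E →ₗ[ℂ] EnvelopingSpace I g :=
  (UniformSpace.Completion.toComplₗᵢ (𝕜 := ℂ) (E := PreEnveloping I g)).toLinearMap

lemma CStarInner.inner_toEnveloping (I : CStarInner C E) (g : CStarState C) (x y : E) :
    @inner ℂ (EnvelopingSpace I g) InnerProductSpace.toInner
      (I.toEnveloping g x) (I.toEnveloping g y) = g (I.form x y) :=
  UniformSpace.Completion.inner_coe (𝕜 := ℂ) (E := PreEnveloping I g) x y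

lemma CStarInner.denseRange_toEnveloping (I : CStarInner C E) (g : CStarState C) :
    DenseRange (I.toEnveloping g) :=
  UniformSpace.Completion.denseRange_coe (α := PreEnveloping I g)

/-- A C⋆-algebra as a Hilbert module over itself, `⟨x, y⟩ = x⋆ y`. -/
def CStarInner.self (C : Type*) [CStarAlgebra C] : CStarInner C C where
  form x y := star x * y
  star_form x y := by simp
  add_left x y z := by rw [star_add, add_mul]
  smul_left c x y := by rw [star_smul, smul_mul_assoc]
  nonneg x := ⟨x, rfl⟩

end Enveloping

section StdModule
variable {ι B : Type*} [CStarAlgebra B]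

lemma summable_of_le_of_nonneg [PartialOrder B] [StarOrderedRing B] {v w : ι → B}
    (h0 : ∀ i, 0 ≤ v i) (h : ∀ i, v i ≤ w i) (hw : Summable w) : Summable v := by
  rw [summable_iff_vanishing_norm] at hw ⊢
  intro ε hε
  obtain ⟨s, hs⟩ := hw ε hε
  refine ⟨s, fun t ht => lt_of_le_of_lt ?_ (hs t ht)⟩
  exact CStarAlgebra.norm_le_norm_of_nonneg_of_le (Finset.sum_nonneg fun i _ => h0 i)
    (Finset.sum_le_sum fun i _ => h i)

lemma summable_star_mul_add {x y : ι → B} (hx : Summable fun i => star (x i) * x i)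
    (hy : Summable fun i => star (y i) * y i) :
    Summable fun i => star (x i + y i) * (x i + y i) := by
  let _ := CStarAlgebra.spectralOrder B
  let _ := CStarAlgebra.spectralOrderedRing B
  refine summable_of_le_of_nonneg (fun i => star_mul_self_nonneg _) (fun i => ?_)
    ((hx.add hy).add (hx.add hy))
  have h := star_mul_self_nonneg (x i - y i)
  rw [← sub_nonneg]
  convert h using 1
  simp only [star_add, star_sub]
  noncomm_ring

lemma summable_star_mul_smul {x : ι → B} (c : ℂ) (hx : Summable fun i => star (x i) * x i) :
    Summable fun i => star (c • x i) * (c • x i) := by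
  have := hx.const_smul (star c * c)
  refine this.congr fun i => ?_
  rw [star_smul, smul_mul_assoc, mul_smul_comm, smul_smul]

lemma summable_star_mul_lmul {x : ι → B} (b : B) (hx : Summable fun i => star (x i) * x i) :
    Summable fun i => star (b * x i) * (b * x i) := by
  let _ := CStarAlgebra.spectralOrder B
  let _ := CStarAlgebra.spectralOrderedRing B
  refine summable_of_le_of_nonneg (fun i => star_mul_self_nonneg _) (fun i => ?_)
    (hx.const_smul ‖star b * b‖)
  have := CStarAlgebra.star_left_conjugate_le_norm_smul (a := x i) (b := star b * b)
  simpa [mul_assoc] using this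

variable (ι B) in
/-- The standard Hilbert module over `B` on an index set `ι`: the families `(b i)` for which
`∑ i, (b i)⋆ (b i)` converges in norm. The terms are positive, so for `ι = ℕ` unconditional
convergence is the same as convergence of the series. -/
def StdModule : Submodule ℂ (ι → B) where
  carrier := {x | Summable fun i => star (x i) * x i}
  zero_mem' := by simpa using summable_zero
  add_mem' := summable_star_mul_add
  smul_mem' c _ := summable_star_mul_smul c

namespace StdModule

lemma summable_form (x y : StdModule ι B) : Summable fun i => star (x.1 i) * y.1 i := by
  have h1 : Summable _ := (x + y).2
  have h2 : Summable _ := (x - y).2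
  have h3 : Summable _ := (x + Complex.I • y).2
  have h4 : Summable _ := (x - Complex.I • y).2
  have h := (((h1.sub h2).sub (h3.const_smul Complex.I)).add
    (h4.const_smul Complex.I)).const_smul (1 / 4 : ℂ)
  refine h.congr fun i => ?_
  simp only [Submodule.coe_add, Submodule.coe_sub, Submodule.coe_smul, Pi.add_apply, Pi.sub_apply,
    Pi.smul_apply, star_add, star_sub, star_smul, add_mul, mul_add, sub_mul, mul_sub,
    smul_mul_assoc, mul_smul_comm, Complex.star_def, Complex.conj_I, smul_add, smul_sub, smul_smul]
  match_scalars <;> ring_nf <;> simp <;> norm_num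

/-- The action of `B` from the left, `b • (x i) = (b * x i)`. -/
def lmul (b : B) : StdModule ι B →ₗ[ℂ] StdModule ι B where
  toFun x := ⟨fun i => b * x.1 i, summable_star_mul_lmul b x.2⟩
  map_add' x y := by ext i; exact mul_add _ _ _
  map_smul' c x := by ext i; exact mul_smul_comm _ _ _

variable (ι B) in
/-- The inner product `⟨x, y⟩ = ∑ i, (x i)⋆ (y i)` of the standard Hilbert module. -/
def inner : CStarInner B (StdModule ι B) where
  form x y := ∑' i, star (x.1 i) * y.1 i
  star_form x y := by rw [tsum_star]; simp
  add_left x y z := by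
    rw [← (summable_form x z).tsum_add (summable_form y z)]
    simp [add_mul]
  smul_left c x y := by
    rw [← (summable_form x y).tsum_const_smul]
    simp
  nonneg x := by
    let _ := CStarAlgebra.spectralOrder B
    let _ := CStarAlgebra.spectralOrderedRing B
    exact CStarAlgebra.nonneg_iff_eq_star_mul_self.mp
      (tsum_nonneg fun i => star_mul_self_nonneg (x.1 i))

end StdModule
end StdModule

section QuantumGroup

/-- A unital C⋆-algebra `A` is nuclear if for every C⋆-algebra `B` there is at most one C⋆-norm on
the algebraic tensor product `A ⊗ B`. (It is enough to test unital `B`, by passing to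
unitizations; a C⋆-norm always exists.) For nuclear `A` the maximal tensor product
`CStarTensor A B` is therefore the only C⋆-tensor product of `A` and `B`. -/
def IsNuclear (A : Type u) [CStarAlgebra A] : Prop :=
  ∀ (B : Type u) [CStarAlgebra B] (p q : CStarSeminorm (A ⊗[ℂ] B)),
    p.IsNorm → q.IsNorm → ∀ x, p x = q x

open CStarTensor in
/-- A unital C⋆-algebraic (that is, compact) quantum group structure on `A`: a coassociative unital
⋆-homomorphism `Δ : A → A ⊗ A` such that the linear spans of `Δ(A)(A ⊗ 1)` and `Δ(A)(1 ⊗ A)` are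
dense in `A ⊗ A`. -/
structure CompactQuantumGroup (A : Type*) [CStarAlgebra A] where
  comul : A →⋆ₐ[ℂ] CStarTensor A A
  coassoc : ∀ a, assoc A A A (map comul (StarAlgHom.id ℂ A) (comul a)) =
    map (StarAlgHom.id ℂ A) comul (comul a)
  dense_left : Dense (Submodule.span ℂ {x | ∃ a b, x = comul a * inl A A b} : Set (CStarTensor A A))
  dense_right : Dense (Submodule.span ℂ {x | ∃ a b, x = comul a * inr A A b} : Set (CStarTensor A A))

/-- The state `f` is right invariant: `(f ⊗ id) Δ(a) = f(a) 1`. -/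
def CompactQuantumGroup.IsRightInvariant {A : Type*} [CStarAlgebra A] (G : CompactQuantumGroup A)
    (f : CStarState A) : Prop :=
  ∀ a, f.sliceLeft A (G.comul a) = f a • (1 : A)

open CStarTensor in
/-- A left co-action of a compact quantum group on a unital C⋆-algebra `B`: a ⋆-homomorphism
`δ : B → A ⊗ B` with `(id ⊗ δ) δ = (Δ ⊗ id) δ` such that the linear span of `δ(B)(A ⊗ 1)` is dense
in `A ⊗ B`. Here `A ⊗ B` is unital, hence its own multiplier algebra, and the density makes the
projection `δ(1)` the unit, so `δ` is unital. -/
structure LeftCoaction {A : Type*} [CStarAlgebra A] (G : CompactQuantumGroup A)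
    (B : Type*) [CStarAlgebra B] where
  hom : B →⋆ₐ[ℂ] CStarTensor A B
  coassoc : ∀ b, assoc A A B (map G.comul (StarAlgHom.id ℂ B) (hom b)) =
    map (StarAlgHom.id ℂ A) hom (hom b)
  dense : Dense (Submodule.span ℂ {x | ∃ b a, x = hom b * inl A B a} : Set (CStarTensor A B))

/-- The state `η` is invariant under the co-action: `(id ⊗ η) δ(b) = η(b) 1`. -/
def LeftCoaction.IsInvariant {A : Type*} [CStarAlgebra A] {G : CompactQuantumGroup A}
    {B : Type*} [CStarAlgebra B] (δ : LeftCoaction G B) (η : CStarState B) : Prop :=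
  ∀ b, η.sliceRight A (δ.hom b) = η b • (1 : A)

end QuantumGroup

end

/-! Two independent arguments are combined.

Faithfulness of `f ⊗ η`. If `(f ⊗ η)(y⋆y) = 0`, Cauchy–Schwarz gives `(f ⊗ η)(z y) = 0` for every
`z`, so both slices of `y⋆y` are annihilated by a faithful state and vanish. Hence `y(a ⊗ b)` is
again null for all `a`, `b`, and the tensor product of the two GNS representations sends `y` to an
operator vanishing on a dense set of vectors, that is, to zero (`prodRepExt_eq_zero`). On the
algebraic tensor product the norm of this representation is a C⋆-norm, because the GNS maps of
faithful states are injective. Nuclearity identifies it with the maximal norm, so the extended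
representation is isometric and `y = 0` (`IsFaithful.prod`).

The unitary. Separability and Gram–Schmidt provide a family `e i` in `A`, orthonormal for `f (a⋆ b)`
and with norm dense span, indexed by `ι` (`CStarState.IsFaithful.exists_orthonormal`). Put `W (b i)
= ∑ i, δ(b i)(e i ⊗ 1)` on finitely supported families. Since `δ` is multiplicative, `W` intertwines
the left actions. Invariance of `η` gives `(f ⊗ η)((δ(b)(a ⊗ 1))⋆ δ(d)(c ⊗ 1)) = f(a⋆ c) η(b⋆ d)`
(`LeftCoaction.prod_star_mul`), so `W` is isometric for the scalar norms by orthonormality of the `e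
i`. Its range is dense because the span of the `e i` is dense in `A` and that of `δ(B)(A ⊗ 1)` is
dense in `A ⊗ B` (`LeftCoaction.denseRange_finSuppMap`). The finitely supported families are dense
in the enveloping space, so `W` extends to a unitary. -/

noncomputable section

/-! ### Faithfulness of the product state -/

namespace CStarState
section
variable {A B : Type*} [CStarAlgebra A] [CStarAlgebra B]

lemma continuous_prod (f : CStarState A) (g : CStarState B) : Continuous (f.prod g) :=
  (CStarTensor.extend (algProd f g) (algProd_bound f g)).continuous

lemma continuous (f : CStarState A) : Continuous f := by
  let _ := CStarAlgebra.spectralOrder A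
  let _ := CStarAlgebra.spectralOrderedRing A
  exact map_continuous f.toPLM

/-- The identity `f ⊗ g = f ∘ (id ⊗ g)`, together with the `A`-bimodule property of the slice `id ⊗
g`. Both sides are continuous in `z`, so elementary tensors suffice. -/
lemma prod_inl_mul_mul_inl (f : CStarState A) (g : CStarState B) (c d : A) (z : CStarTensor A B) :
    f.prod g (CStarTensor.inl A B c * z * CStarTensor.inl A B d) =
      f (c * g.sliceRight A z * d) := by
  refine CStarTensor.denseRange_of.induction_on (p := fun z =>
    f.prod g (CStarTensor.inl A B c * z * CStarTensor.inl A B d) =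
      f (c * g.sliceRight A z * d)) z ?_ fun x => ?_
  · exact isClosed_eq ((continuous_prod f g).comp (by fun_prop))
      (f.continuous.comp (by fun_prop))
  · induction x with
    | zero => simp
    | add x y hx hy =>
      rw [map_add, map_add, mul_add, add_mul, mul_add, add_mul, map_add, map_add, hx, hy]
    | tmul a b =>
      change f.prod g (CStarTensor.of A B (c ⊗ₜ 1) * CStarTensor.of A B (a ⊗ₜ b) *
        CStarTensor.of A B (d ⊗ₜ 1)) = _
      rw [← map_mul, ← map_mul, Algebra.TensorProduct.tmul_mul_tmul,
        Algebra.TensorProduct.tmul_mul_tmul, prod_tmul, sliceRight_tmul]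
      simp [mul_comm]

lemma prod_inr_mul_mul_inr (f : CStarState A) (g : CStarState B) (c d : B) (z : CStarTensor A B) :
    f.prod g (CStarTensor.inr A B c * z * CStarTensor.inr A B d) =
      g (c * f.sliceLeft B z * d) := by
  refine CStarTensor.denseRange_of.induction_on (p := fun z =>
    f.prod g (CStarTensor.inr A B c * z * CStarTensor.inr A B d) =
      g (c * f.sliceLeft B z * d)) z ?_ fun x => ?_
  · exact isClosed_eq ((continuous_prod f g).comp (by fun_prop))
      (g.continuous.comp (by fun_prop))
  · induction x with
    | zero => simp
    | add x y hx hy =>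
      rw [map_add, map_add, mul_add, add_mul, mul_add, add_mul, map_add, map_add, hx, hy]
    | tmul a b =>
      change f.prod g (CStarTensor.of A B (1 ⊗ₜ c) * CStarTensor.of A B (a ⊗ₜ b) *
        CStarTensor.of A B (1 ⊗ₜ d)) = _
      rw [← map_mul, ← map_mul, Algebra.TensorProduct.tmul_mul_tmul,
        Algebra.TensorProduct.tmul_mul_tmul, prod_tmul, sliceLeft_tmul]
      simp

/-- Cauchy–Schwarz for `f (x⋆ y)`, applied to the pair `z⋆`, `y`. -/
lemma mul_eq_zero_of_star_mul_self_eq_zero (f : CStarState A) {y : A} (hy : f (star y * y) = 0)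
    (z : A) : f (z * y) = 0 := by
  let _ := CStarAlgebra.spectralOrder A
  let _ := CStarAlgebra.spectralOrderedRing A
  have h0 : ‖f.toPLM.toPreGNS y‖ = 0 := by
    rw [PositiveLinearMap.preGNS_norm_def]
    change √(f (star y * y)).re = 0
    simp [hy]
  have h1 := norm_inner_le_norm (𝕜 := ℂ) (f.toPLM.toPreGNS (star z)) (f.toPLM.toPreGNS y)
  rw [h0, mul_zero, PositiveLinearMap.preGNS_inner_def] at h1
  have h2 : f (star (star z) * y) = 0 := norm_le_zero_iff.1 h1
  rwa [star_star] at h2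

/-- With `s` the slice of `y⋆y`, the number `g(s⋆ s)` equals `(f ⊗ g)((1 ⊗ s⋆) y⋆ y)`, which
vanishes since `y` is a null vector. Faithfulness of `g` then gives `s = 0`. -/
lemma sliceLeft_eq_zero {f : CStarState A} {g : CStarState B} (hg : g.IsFaithful)
    {y : CStarTensor A B} (hy : f.prod g (star y * y) = 0) :
    f.sliceLeft B (star y * y) = 0 := by
  apply hg
  have h := prod_inr_mul_mul_inr f g (star (f.sliceLeft B (star y * y))) 1 (star y * y)
  rw [mul_one, _root_.map_one, mul_one] at h
  rw [← h, ← mul_assoc]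
  exact mul_eq_zero_of_star_mul_self_eq_zero _ hy _

lemma sliceRight_eq_zero {f : CStarState A} {g : CStarState B} (hf : f.IsFaithful)
    {y : CStarTensor A B} (hy : f.prod g (star y * y) = 0) :
    g.sliceRight A (star y * y) = 0 := by
  apply hf
  have h := prod_inl_mul_mul_inl f g (star (g.sliceRight A (star y * y))) 1 (star y * y)
  rw [mul_one, _root_.map_one, mul_one] at h
  rw [← h, ← mul_assoc]
  exact mul_eq_zero_of_star_mul_self_eq_zero _ hy _

/-- The null vectors of a state form a left ideal. Here they are also stable under right
multiplication by elementary tensors: `(f ⊗ g)((a⋆ ⊗ 1) y⋆y (a ⊗ 1)) = f(a⋆ s a)` with `s` a slice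
of `y⋆y`, and `s = 0`. The same argument with the other slice handles `1 ⊗ b`. -/
lemma prod_star_mul_self_mul_of_tmul {f : CStarState A} {g : CStarState B} (hf : f.IsFaithful)
    (hg : g.IsFaithful) {y : CStarTensor A B} (hy : f.prod g (star y * y) = 0) (a : A) (b : B) :
    f.prod g (star (y * CStarTensor.of A B (a ⊗ₜ b)) * (y * CStarTensor.of A B (a ⊗ₜ b))) = 0 := by
  have h1 : f.prod g (star (y * CStarTensor.inl A B a) * (y * CStarTensor.inl A B a)) = 0 := by
    have h := prod_inl_mul_mul_inl f g (star a) a (star y * y)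
    rw [sliceRight_eq_zero hf hy, mul_zero, zero_mul, map_zero] at h
    rw [← h, star_mul, StarHomClass.map_star]
    simp only [mul_assoc]
  have h := prod_inr_mul_mul_inr f g (star b) b
    (star (y * CStarTensor.inl A B a) * (y * CStarTensor.inl A B a))
  rw [sliceLeft_eq_zero hg h1, mul_zero, zero_mul, map_zero] at h
  have h2 : CStarTensor.of A B (a ⊗ₜ b) = CStarTensor.inl A B a * CStarTensor.inr A B b := by
    change _ = CStarTensor.of A B (a ⊗ₜ 1) * CStarTensor.of A B (1 ⊗ₜ b)
    rw [← map_mul]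
    simp
  rw [← h, h2, ← mul_assoc y, star_mul _ (CStarTensor.inr A B b), StarHomClass.map_star]
  simp only [mul_assoc]

/-! ### The tensor product of the GNS representations -/

lemma toGNS_injective [PartialOrder A] [StarOrderedRing A] {f : CStarState A}
    (hf : f.IsFaithful) :
    Function.Injective fun a : A => (f.toPLM.toPreGNS a : f.toPLM.GNS) := by
  intro a b h
  have h0 : ‖(f.toPLM.toPreGNS (a - b) : f.toPLM.GNS)‖ = 0 := by
    rw [map_sub, UniformSpace.Completion.coe_sub, sub_eq_zero.2 h, norm_zero]
  rw [UniformSpace.Completion.norm_coe] at h0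
  have h1 := PositiveLinearMap.preGNS_norm_sq f.toPLM (f.toPLM.toPreGNS (a - b))
  rw [h0] at h1
  refine sub_eq_zero.1 (hf _ (h1.symm.trans ?_))
  simp

/-- The canonical map from a C⋆-algebra to the GNS space of a state. -/
def toGNS [PartialOrder A] [StarOrderedRing A] (f : CStarState A) : A →ₗ[ℂ] f.toPLM.GNS :=
  (UniformSpace.Completion.toComplₗᵢ (𝕜 := ℂ) (E := f.toPLM.PreGNS)).toLinearMap ∘ₗ
    f.toPLM.toPreGNS.toLinearMap

section
variable [PartialOrder A] [StarOrderedRing A] [PartialOrder B] [StarOrderedRing B]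

lemma prodRep_prodVec (f : CStarState A) (g : CStarState B) (x : A ⊗[ℂ] B) :
    prodRep f.toPLM g.toPLM x (prodVec f.toPLM g.toPLM) =
      TensorProduct.map f.toGNS g.toGNS x := by
  induction x with
  | zero => simp
  | add x y hx hy => rw [map_add, map_add, add_apply, hx, hy]
  | tmul a b =>
    rw [prodVec, prodRep_tmul, TensorProduct.map_tmul]
    congr 1 <;> simp [toGNS]

/-- The cyclic vector already separates: `x` moves it to the image of `x` under the tensor product
of the two GNS maps. These are injective, and over a field so is their tensor product. -/
lemma eq_zero_of_norm_prodRep {f : CStarState A} {g : CStarState B} (hf : f.IsFaithful)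
    (hg : g.IsFaithful) {x : A ⊗[ℂ] B} (hx : ‖prodRep f.toPLM g.toPLM x‖ = 0) : x = 0 := by
  have h : TensorProduct.map f.toGNS g.toGNS x = 0 := by
    have h := (prodRep f.toPLM g.toPLM x).le_opNorm (prodVec f.toPLM g.toPLM)
    rw [hx, zero_mul, prodRep_prodVec] at h
    exact norm_le_zero_iff.1 h
  exact TensorProduct.map_injective_of_flat_flat _ _ (toGNS_injective hf) (toGNS_injective hg)
    (h.trans (map_zero _).symm)

/-- The tensor product of two GNS representations, on the C⋆-tensor product. -/
def prodRepExt (f : CStarState A) (g : CStarState B) : CStarTensor A B →L[ℂ]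
    (f.toPLM.GNS ⊗[ℂ] g.toPLM.GNS →L[ℂ]
      UniformSpace.Completion (f.toPLM.GNS ⊗[ℂ] g.toPLM.GNS)) :=
  -- The algebraic tensor product of the GNS spaces need not be complete. Operators into its
  -- completion form a complete space, as extension by continuity requires.
  CStarTensor.extend
    (((ContinuousLinearMap.compL ℂ (f.toPLM.GNS ⊗[ℂ] g.toPLM.GNS) (f.toPLM.GNS ⊗[ℂ] g.toPLM.GNS)
      (UniformSpace.Completion (f.toPLM.GNS ⊗[ℂ] g.toPLM.GNS))
        UniformSpace.Completion.toComplL).toLinearMap) ∘ₗ (prodRep f.toPLM g.toPLM).toLinearMap)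
    fun x => (ContinuousLinearMap.opNorm_le_bound _ (maxNorm_nonneg x) fun v =>
      (UniformSpace.Completion.norm_coe _).trans_le
        ((prodRep f.toPLM g.toPLM x).le_of_opNorm_le (prodRep_le _ _ x) v))

lemma prodRepExt_of (f : CStarState A) (g : CStarState B) (x : A ⊗[ℂ] B)
    (v : f.toPLM.GNS ⊗[ℂ] g.toPLM.GNS) :
    prodRepExt f g (CStarTensor.of A B x) v = (prodRep f.toPLM g.toPLM x v :) := by
  rw [prodRepExt, CStarTensor.extend_of]
  rfl

lemma norm_prodRepExt_of (f : CStarState A) (g : CStarState B) (x : A ⊗[ℂ] B) :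
    ‖prodRepExt f g (CStarTensor.of A B x)‖ = ‖prodRep f.toPLM g.toPLM x‖ := by
  apply le_antisymm
  · refine ContinuousLinearMap.opNorm_le_bound _ (ContinuousLinearMap.opNorm_nonneg _) fun v => ?_
    rw [prodRepExt_of, UniformSpace.Completion.norm_coe]
    exact ContinuousLinearMap.le_opNorm _ _
  · refine ContinuousLinearMap.opNorm_le_bound _ (ContinuousLinearMap.opNorm_nonneg _) fun v => ?_
    rw [← UniformSpace.Completion.norm_coe, ← prodRepExt_of]
    exact ContinuousLinearMap.le_opNorm _ _

lemma prodRepExt_mul_of (f : CStarState A) (g : CStarState B) (y : CStarTensor A B)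
    (x : A ⊗[ℂ] B) (v : f.toPLM.GNS ⊗[ℂ] g.toPLM.GNS) :
    prodRepExt f g (y * CStarTensor.of A B x) v =
      prodRepExt f g y (prodRep f.toPLM g.toPLM x v) := by
  refine CStarTensor.denseRange_of.induction_on (p := fun y =>
    prodRepExt f g (y * CStarTensor.of A B x) v =
      prodRepExt f g y (prodRep f.toPLM g.toPLM x v)) y ?_ fun z => ?_
  · exact isClosed_eq (by fun_prop) (by fun_prop)
  · rw [← map_mul, prodRepExt_of, prodRepExt_of, map_mul, mul_apply_eq_comp]

lemma norm_prodRepExt_prodVec_sq (f : CStarState A) (g : CStarState B) (y : CStarTensor A B) :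
    ((‖prodRepExt f g y (prodVec f.toPLM g.toPLM)‖ ^ 2 : ℝ) : ℂ) = f.prod g (star y * y) := by
  refine CStarTensor.denseRange_of.induction_on (p := fun y =>
    ((‖prodRepExt f g y (prodVec f.toPLM g.toPLM)‖ ^ 2 : ℝ) : ℂ) = f.prod g (star y * y)) y
    ?_ fun z => ?_
  · refine isClosed_eq (by fun_prop) ((continuous_prod f g).comp ?_)
    exact continuous_star.mul continuous_id
  · rw [← StarHomClass.map_star, ← map_mul, prodRepExt_of, UniformSpace.Completion.norm_coe]
    refine (inner_self_tensor _ _ _).symm.trans ((algProd_star_mul f g z z).symm.trans ?_)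
    exact (CStarTensor.extend_of _ (algProd_bound f g) _).symm

/-- The squared norm of the image of the cyclic vector under `y(a ⊗ b)` is the value of `f ⊗ g` at
`(y(a ⊗ b))⋆ y(a ⊗ b)`, which is zero. So `y` kills every vector of the form `a ⊗ b` with `a`, `b`
coming from the algebras; continuity and linearity do the rest. -/
lemma prodRepExt_eq_zero {f : CStarState A} {g : CStarState B} (hf : f.IsFaithful)
    (hg : g.IsFaithful) {y : CStarTensor A B} (hy : f.prod g (star y * y) = 0) :
    prodRepExt f g y = 0 := by
  have h1 (a : A) (b : B) : prodRepExt f g y (f.toGNS a ⊗ₜ g.toGNS b) = 0 := by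
    have h := norm_prodRepExt_prodVec_sq f g (y * CStarTensor.of A B (a ⊗ₜ b))
    rw [prod_star_mul_self_mul_of_tmul hf hg hy, prodRepExt_mul_of, prodRep_prodVec,
      TensorProduct.map_tmul] at h
    simpa using h
  ext v
  rw [zero_apply]
  induction v with
  | zero => rw [map_zero]
  | add v w hv hw => rw [map_add, hv, hw, add_zero]
  | tmul p q =>
    refine UniformSpace.Completion.induction_on₂ (p := fun p q => prodRepExt f g y (p ⊗ₜ q) = 0)
      p q ?_ fun a b => h1 (f.toPLM.ofPreGNS a) (g.toPLM.ofPreGNS b)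
    exact isClosed_eq ((prodRepExt f g y).continuous.comp TensorProduct.continuous_tmul)
      continuous_const

end
end

/-- The product of faithful states is faithful on the maximal tensor product if one of the
factors is nuclear. -/
lemma IsFaithful.prod {A B : Type u} [CStarAlgebra A] [CStarAlgebra B] (hA : IsNuclear A)
    {f : CStarState A} {g : CStarState B} (hf : f.IsFaithful) (hg : g.IsFaithful) :
    (f.prod g).IsFaithful := by
  intro y hy
  let _ := CStarAlgebra.spectralOrder A
  let _ := CStarAlgebra.spectralOrderedRing A
  let _ := CStarAlgebra.spectralOrder B
  let _ := CStarAlgebra.spectralOrderedRing B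
  set p := CStarSeminorm.ofRep (prodRep f.toPLM g.toPLM) (prodRep_star f.toPLM g.toPLM)
  have hp : p.IsNorm := fun x hx => eq_zero_of_norm_prodRep hf hg hx
  -- The maximal seminorm dominates the norm `p`, so it is a norm as well and nuclearity applies to
  -- the pair.
  have hm : (maxSeminorm A B).IsNorm := fun x hx =>
    hp x (le_antisymm ((p.le_maxNorm x).trans_eq hx) (p.nonneg x))
  have hc : Continuous fun T : (f.toPLM.GNS ⊗[ℂ] g.toPLM.GNS →L[ℂ]
      UniformSpace.Completion (f.toPLM.GNS ⊗[ℂ] g.toPLM.GNS)) => ‖T‖ := by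
    exact continuous_norm (E := (f.toPLM.GNS ⊗[ℂ] g.toPLM.GNS →L[ℂ]
      UniformSpace.Completion (f.toPLM.GNS ⊗[ℂ] g.toPLM.GNS)))
  have h : ‖prodRepExt f g y‖ = ‖y‖ := by
    refine CStarTensor.denseRange_of.induction_on (p := fun y => ‖prodRepExt f g y‖ = ‖y‖) y
      (isClosed_eq (hc.comp (prodRepExt f g).continuous) continuous_norm) fun x => ?_
    rw [norm_prodRepExt_of, CStarTensor.norm_of]
    exact hA B p (maxSeminorm A B) hp hm x
  rw [prodRepExt_eq_zero hf hg hy] at h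
  exact norm_eq_zero.1 (h.symm.trans ContinuousLinearMap.opNorm_zero)

end CStarState

/-! ### Orthonormal families with dense span -/

section Orthonormal

/-- Gram–Schmidt. The inner product is passed as a core, so that its norm does not compete with a
norm that `E` may already carry. The spans agree algebraically, hence density survives for any
topology on `E`. -/
lemma exists_orthonormal_of_linearIndependent {E κ : Type*} [AddCommGroup E] [Module ℂ E]
    [LinearOrder κ] [LocallyFiniteOrderBot κ] [WellFoundedLT κ] (c : InnerProductSpace.Core ℂ E)
    {v : κ → E} (hv : LinearIndependent ℂ v) :
    ∃ e : κ → E, (∀ i, c.inner (e i) (e i) = 1) ∧ (∀ i j, i ≠ j → c.inner (e i) (e j) = 0) ∧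
      Submodule.span ℂ (Set.range e) = Submodule.span ℂ (Set.range v) := by
  let _ : NormedAddCommGroup E := c.toNormedAddCommGroup
  let _ : InnerProductSpace ℂ E := InnerProductSpace.ofCore c.toCore
  have h := InnerProductSpace.gramSchmidtNormed_orthonormal (𝕜 := ℂ) hv
  refine ⟨InnerProductSpace.gramSchmidtNormed ℂ v, fun i => ?_, fun i j hij => h.2 hij,
    (InnerProductSpace.span_gramSchmidtNormed_range v).trans
      (InnerProductSpace.span_gramSchmidt ℂ v)⟩
  refine (inner_self_eq_norm_sq_to_K (𝕜 := ℂ) _).trans ?_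
  rw [h.1 i]
  simp

lemma exists_orthonormal_of_countable {E κ : Type*} [AddCommGroup E] [Module ℂ E]
    [Countable κ] (c : InnerProductSpace.Core ℂ E) {v : κ → E} (hv : LinearIndependent ℂ v) :
    ∃ e : κ → E, (∀ i, c.inner (e i) (e i) = 1) ∧ (∀ i j, i ≠ j → c.inner (e i) (e j) = 0) ∧
      Submodule.span ℂ (Set.range e) = Submodule.span ℂ (Set.range v) := by
  -- Gram–Schmidt needs an order with finite initial segments; it is obtained by numbering `κ` by
  -- `Fin n` or by `ℕ`.
  have key : ∀ (κ' : Type) [LinearOrder κ'] [LocallyFiniteOrderBot κ'] [WellFoundedLT κ']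
      (s : κ ≃ κ'), ∃ e : κ → E, (∀ i, c.inner (e i) (e i) = 1) ∧
        (∀ i j, i ≠ j → c.inner (e i) (e j) = 0) ∧
        Submodule.span ℂ (Set.range e) = Submodule.span ℂ (Set.range v) := by
    intro κ' _ _ _ s
    obtain ⟨e, h1, h2, h3⟩ :=
      exists_orthonormal_of_linearIndependent c (hv.comp s.symm s.symm.injective)
    refine ⟨e ∘ s, fun i => h1 _, fun i j hij => h2 _ _ (s.injective.ne hij), ?_⟩
    rw [s.surjective.range_comp, h3, s.symm.surjective.range_comp]
  cases finite_or_infinite κ with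
  | inl h =>
    obtain ⟨n, ⟨s⟩⟩ := Finite.exists_equiv_fin κ
    exact key (Fin n) s
  | inr h => exact key ℕ (nonempty_equiv_of_countable (α := κ) (β := ℕ)).some

-- A maximal linearly independent subset of a countable dense set has dense span. It remains to
-- match its cardinality with that of `ι`.
open Cardinal in
lemma exists_linearIndependent_dense_span {A : Type*} [NormedAddCommGroup A] [NormedSpace ℂ A]
    [TopologicalSpace.SeparableSpace A] {ι : Type} [Countable ι]
    (hι : ENat.card ι = Cardinal.toENat (Module.rank ℂ A)) :
    ∃ v : ι → A, LinearIndependent ℂ v ∧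
      Dense (Submodule.span ℂ (Set.range v) : Set A) := by
  obtain ⟨s, hs, hsd⟩ := TopologicalSpace.exists_countable_dense A
  obtain ⟨b, hbs, hspan, hb⟩ := exists_linearIndependent ℂ s
  have hbd : Dense (Submodule.span ℂ b : Set A) := by
    rw [hspan]; exact hsd.mono Submodule.subset_span
  have : Countable b := (hs.mono hbs).to_subtype
  suffices h : Nonempty (ι ≃ b) by
    obtain ⟨e⟩ := h
    refine ⟨fun i => e i, hb.comp e e.injective, ?_⟩
    have : Set.range (fun i => (e i : A)) = b := by
      rw [show (fun i => (e i : A)) = (↑) ∘ e from rfl, e.surjective.range_comp,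
        Subtype.range_coe]
    rwa [this]
  cases finite_or_infinite b with
  | inl h =>
    have : FiniteDimensional ℂ (Submodule.span ℂ b) :=
      FiniteDimensional.span_of_finite ℂ (Set.toFinite b)
    -- A finite-dimensional subspace is closed, so the dense span is everything and `b` is a basis.
    have htop : Submodule.span ℂ b = ⊤ := by
      rw [← SetLike.coe_set_eq,
        ← (Submodule.closed_of_finiteDimensional (Submodule.span ℂ b)).closure_eq, hbd.closure_eq]
      rfl
    let B := Module.Basis.mk hb (by rw [Subtype.range_coe, htop])
    rw [← B.mk_eq_rank''] at hι
    have hc : ENat.card ι = ENat.card b := hι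
    have hι' : Finite ι := by
      rw [← ENat.card_lt_top, hc]; exact ENat.card_lt_top.2 h
    rw [ENat.card_eq_coe_natCard, ENat.card_eq_coe_natCard] at hc
    exact Finite.card_eq.1 (by exact_mod_cast hc)
  | inr h =>
    -- The rank is then infinite, possibly uncountable, but `hι` only compares after truncation to
    -- `ℕ∞`. So `ι` and `b` are both countably infinite.
    have : Infinite ι := by
      rw [← ENat.card_eq_top, hι, Cardinal.toENat_eq_top]
      exact (Cardinal.aleph0_le_mk b).trans hb.cardinal_le_rank
    exact nonempty_equiv_of_countable

/-- The scalar product `f (a⋆ b)` of a faithful state `f`. -/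
abbrev CStarState.IsFaithful.core {A : Type*} [CStarAlgebra A] {f : CStarState A}
    (hf : f.IsFaithful) : InnerProductSpace.Core ℂ A where
  __ := PreEnveloping.core (CStarInner.self A) f
  definite := hf

lemma CStarState.IsFaithful.exists_orthonormal {A : Type*} [CStarAlgebra A]
    [TopologicalSpace.SeparableSpace A] {f : CStarState A} (hf : f.IsFaithful)
    {ι : Type} [Countable ι] (hι : ENat.card ι = Cardinal.toENat (Module.rank ℂ A)) :
    ∃ e : ι → A, (∀ i, f (star (e i) * e i) = 1) ∧ (∀ i j, i ≠ j → f (star (e i) * e j) = 0) ∧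
      Dense (Submodule.span ℂ (Set.range e) : Set A) := by
  obtain ⟨v, hv, hd⟩ := exists_linearIndependent_dense_span hι
  obtain ⟨e, h1, h2, h3⟩ := exists_orthonormal_of_countable hf.core hv
  exact ⟨e, h1, h2, h3 ▸ hd⟩

end Orthonormal

/-! ### Enveloping Hilbert spaces -/

namespace CStarInner
variable {C E : Type*} [CStarAlgebra C] [AddCommGroup E] [Module ℂ E]

lemma norm_toEnveloping_sq (I : CStarInner C E) (g : CStarState C) (x : E) :
    ((‖I.toEnveloping g x‖ ^ 2 : ℝ) : ℂ) = g (I.form x x) :=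
  (inner_self_ofReal (E := EnvelopingSpace I g) _).symm.trans (I.inner_toEnveloping g x x)

/-- A positive `p` satisfies `p ≤ ‖p‖ 1`, so a state takes a value at most `‖p‖` on it. Convergence
for the C⋆-valued inner product therefore implies convergence in the enveloping space. -/
lemma norm_toEnveloping_sq_le (I : CStarInner C E) (g : CStarState C) (x : E) :
    ‖I.toEnveloping g x‖ ^ 2 ≤ ‖I.form x x‖ := by
  let _ := CStarAlgebra.spectralOrder C
  let _ := CStarAlgebra.spectralOrderedRing C
  obtain ⟨c, hc⟩ := I.nonneg x
  have h : ‖g (I.form x x)‖ ≤ ‖I.form x x‖ := by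
    have h1 : I.form x x ≤ algebraMap ℝ C ‖I.form x x‖ :=
      IsSelfAdjoint.le_algebraMap_norm_self (by rw [hc]; exact .star_mul_self c)
    have h2 : (0 : C) ≤ I.form x x := by rw [hc]; exact star_mul_self_nonneg c
    have h3 : g (I.form x x) ≤ g (algebraMap ℝ C ‖I.form x x‖) := OrderHomClass.mono g.toPLM h1
    have h4 : (0 : ℂ) ≤ g (I.form x x) := by rw [hc]; exact g.nonneg c
    have h5 : g (algebraMap ℝ C ‖I.form x x‖) = (‖I.form x x‖ : ℂ) := by
      rw [Algebra.algebraMap_eq_smul_one, ← Complex.coe_smul, map_smul, g.map_one, smul_eq_mul,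
        mul_one]
    rw [h5] at h3
    rw [Complex.nonneg_iff] at h4
    rw [Complex.le_def] at h3
    rw [← Complex.re_eq_norm.2 (Complex.nonneg_iff.2 h4)]
    simpa using h3.1
  rw [← norm_toEnveloping_sq] at h
  simpa using h

lemma continuous_toEnveloping_self (g : CStarState C) :
    Continuous ((CStarInner.self C).toEnveloping g) := by
  refine AddMonoidHomClass.continuous_of_bound ((CStarInner.self C).toEnveloping g) 1 fun x => ?_
  rw [one_mul]
  refine (sq_le_sq₀ (norm_nonneg _) (norm_nonneg _)).1 ?_
  refine (norm_toEnveloping_sq_le _ g x).trans ?_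
  rw [sq, ← CStarRing.norm_star_mul_self]
  rfl

/-- A densely defined isometric map with dense range extends to a unitary of the enveloping Hilbert
spaces. -/
lemma exists_unitary_of_norm_eq {C' E' : Type*} [CStarAlgebra C'] [AddCommGroup E']
    [Module ℂ E'] (I : CStarInner C E) (g : CStarState C) (I' : CStarInner C' E')
    (g' : CStarState C') (D : Submodule ℂ E) (T : D →ₗ[ℂ] E')
    (hD : DenseRange fun x : D => I.toEnveloping g x)
    (hT : DenseRange fun x : D => I'.toEnveloping g' (T x))
    (h : ∀ x, ‖I'.toEnveloping g' (T x)‖ = ‖I.toEnveloping g x‖) :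
    ∃ U : EnvelopingSpace I g ≃ₗᵢ[ℂ] EnvelopingSpace I' g',
      ∀ x : D, U (I.toEnveloping g x) = I'.toEnveloping g' (T x) :=
  ⟨(LinearEquiv.refl ℂ D).extendOfIsometry (I.toEnveloping g ∘ₗ D.subtype)
    (I'.toEnveloping g' ∘ₗ T) hD hT h, fun x => LinearEquiv.extendOfIsometry_eq _ _ _ hD hT h x⟩

end CStarInner

/-! ### Finitely supported families -/

namespace StdModule
variable {ι B : Type*} [CStarAlgebra B]

variable (ι B) in
/-- The finitely supported families in the standard Hilbert module. -/
def finSupp : Submodule ℂ (StdModule ι B) where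
  carrier := {x | (Function.support (x : ι → B)).Finite}
  zero_mem' := by simp
  add_mem' hx hy := (hx.union hy).subset (Function.support_add _ _)
  smul_mem' c _ hx := hx.subset (Function.support_const_smul_subset c _)

lemma lmul_mem_finSupp (b : B) {x : StdModule ι B} (hx : x ∈ finSupp ι B) :
    lmul b x ∈ finSupp ι B :=
  hx.subset fun _ hi h => hi ((congrArg (b * ·) h).trans (mul_zero b))

lemma summable_star_mul_self_of_finset (s : Finset ι) (v : ι → B) (hv : ∀ i ∉ s, v i = 0) :
    Summable fun i => star (v i) * v i :=
  summable_of_ne_finset_zero (s := s) fun i hi => by rw [hv i hi, mul_zero]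

open Classical in
/-- The restriction of a family to a finite set of indices, extended by zero. -/
def truncate (s : Finset ι) (x : ι → B) : StdModule ι B :=
  ⟨fun i => if i ∈ s then x i else 0,
    summable_star_mul_self_of_finset s _ fun _ hi => if_neg hi⟩

lemma truncate_apply_of_mem {s : Finset ι} (x : ι → B) {i : ι} (hi : i ∈ s) :
    (truncate s x).1 i = x i := if_pos hi

lemma truncate_apply_of_notMem {s : Finset ι} (x : ι → B) {i : ι} (hi : i ∉ s) :
    (truncate s x).1 i = 0 := if_neg hi

lemma truncate_mem_finSupp (s : Finset ι) (x : ι → B) : truncate s x ∈ finSupp ι B :=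
  s.finite_toSet.subset fun i hi => by
    by_contra h
    exact hi (truncate_apply_of_notMem x h)

-- The squared distance from a family to its truncation is at most the norm of a tail of `∑ (x i)⋆
-- (x i)`, which tends to zero.
open Filter Topology in
lemma denseRange_toEnveloping_finSupp (g : CStarState B) :
    DenseRange fun x : finSupp ι B => (inner ι B).toEnveloping g x := by
  have h : Set.range ((inner ι B).toEnveloping g) ⊆
      closure (Set.range fun x : finSupp ι B =>
        (inner ι B).toEnveloping g x) := by
    rintro _ ⟨x, rfl⟩
    refine mem_closure_of_tendsto (b := atTop)
      (f := fun s : Finset ι => (inner ι B).toEnveloping g (truncate s x.1)) ?_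
      (Eventually.of_forall fun s => ⟨⟨_, truncate_mem_finSupp s x.1⟩, rfl⟩)
    rw [tendsto_iff_norm_sub_tendsto_zero]
    have hx : Summable fun i => star (x.1 i) * x.1 i := x.2
    have h0 : Tendsto (fun s : Finset ι =>
        ‖∑ i ∈ s, star (x.1 i) * x.1 i - ∑' i, star (x.1 i) * x.1 i‖) atTop (𝓝 0) :=
      tendsto_iff_norm_sub_tendsto_zero.1 hx.hasSum
    have h1 := h0.sqrt
    rw [Real.sqrt_zero] at h1
    refine squeeze_zero (fun s => norm_nonneg _) (fun s => ?_) h1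
    refine Real.le_sqrt_of_sq_le ?_
    rw [← map_sub]
    refine ((inner ι B).norm_toEnveloping_sq_le g _).trans_eq ?_
    -- The partial sum minus the full sum is the negative of the tail.
    rw [← norm_neg]
    congr 1
    change -(∑' i, star ((truncate s x.1).1 i - x.1 i) * ((truncate s x.1).1 i - x.1 i)) = _
    rw [← hx.sum_add_tsum_compl (s := s)]
    rw [sub_add_cancel_left, neg_inj]
    refine (tsum_congr fun i => ?_).trans
      (tsum_subtype (↑s)ᶜ fun i => star (x.1 i) * x.1 i).symm
    by_cases hi : i ∈ s
    · rw [truncate_apply_of_mem _ hi, sub_self, mul_zero, Set.indicator_of_notMem]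
      simpa using hi
    · rw [truncate_apply_of_notMem _ hi, zero_sub, star_neg, neg_mul_neg, Set.indicator_of_mem]
      simpa using hi
  exact (CStarInner.denseRange_toEnveloping _ g).mono h |>.of_closure

end StdModule

/-! ### The intertwining isometry -/

namespace LeftCoaction
variable {A B : Type*} [CStarAlgebra A] [CStarAlgebra B] {G : CompactQuantumGroup A}

/-- The product is `(a⋆ ⊗ 1) δ(b⋆d) (c ⊗ 1)`. Slicing by `η` replaces `δ(b⋆d)` with the scalar
`η(b⋆d)`, by invariance. -/
lemma prod_star_mul (δ : LeftCoaction G B) {η : CStarState B} (hη : δ.IsInvariant η)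
    (f : CStarState A) (a c : A) (b d : B) :
    f.prod η (star (δ.hom b * CStarTensor.inl A B a) * (δ.hom d * CStarTensor.inl A B c)) =
      f (star a * c) * η (star b * d) := by
  have h := f.prod_inl_mul_mul_inl η (star a) c (δ.hom (star b * d))
  rw [hη, mul_smul_comm, smul_mul_assoc, mul_one, map_smul, smul_eq_mul] at h
  rw [mul_comm (f _), ← h, map_mul δ.hom, StarHomClass.map_star δ.hom,
    StarHomClass.map_star (CStarTensor.inl A B), star_mul]
  simp only [mul_assoc]

variable {ι : Type*}

/-- The map `(b i) ↦ ∑ i, δ (b i) (e i ⊗ 1)` on finitely supported families. -/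
def finSuppMap (δ : LeftCoaction G B) (e : ι → A) :
    StdModule.finSupp ι B →ₗ[ℂ] CStarTensor A B where
  toFun x := ∑ᶠ i, δ.hom (x.1.1 i) * CStarTensor.inl A B (e i)
  map_add' x y := by
    have h (z : StdModule.finSupp ι B) : (Function.support fun i =>
        δ.hom (z.1.1 i) * CStarTensor.inl A B (e i)).Finite :=
      z.2.subset fun i hi h => hi (by simp [h])
    rw [← finsum_add_distrib (h x) (h y)]
    refine finsum_congr fun i => ?_
    rw [← add_mul, ← map_add]
    rfl
  map_smul' c x := by
    rw [RingHom.id_apply, smul_finsum]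
    refine finsum_congr fun i => ?_
    rw [← smul_mul_assoc, ← map_smul]
    rfl

lemma finSuppMap_eq_sum (δ : LeftCoaction G B) (e : ι → A) (x : StdModule.finSupp ι B)
    {s : Finset ι} (hs : ∀ i ∉ s, x.1.1 i = 0) :
    δ.finSuppMap e x = ∑ i ∈ s, δ.hom (x.1.1 i) * CStarTensor.inl A B (e i) :=
  finsum_eq_sum_of_support_subset _ fun i hi => by
    by_contra h
    exact hi (by simp [hs i h])

lemma finSuppMap_lmul (δ : LeftCoaction G B) (e : ι → A) (b : B) (x : StdModule.finSupp ι B)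
    (h : StdModule.lmul b x.1 ∈ StdModule.finSupp ι B) :
    δ.finSuppMap e ⟨StdModule.lmul b x.1, h⟩ = δ.hom b * δ.finSuppMap e x := by
  have hs : ∀ i ∉ x.2.toFinset, x.1.1 i = 0 := fun i hi => by
    by_contra h; exact hi (x.2.mem_toFinset.2 h)
  have hs' : ∀ i ∉ x.2.toFinset, (StdModule.lmul b x.1).1 i = 0 := fun i hi => by
    change b * x.1.1 i = 0
    rw [hs i hi, mul_zero]
  rw [finSuppMap_eq_sum δ e x hs, finSuppMap_eq_sum δ e ⟨_, h⟩ hs', Finset.mul_sum]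
  refine Finset.sum_congr rfl fun i _ => ?_
  rw [← mul_assoc, ← map_mul]
  rfl

/-- In the double sum for the squared norm, the `(i, j)` term is `f((e i)⋆ e j) η((b i)⋆ b j)`, so
only the diagonal survives. -/
lemma norm_finSuppMap (δ : LeftCoaction G B) {η : CStarState B} (hη : δ.IsInvariant η)
    (f : CStarState A) {e : ι → A} (h1 : ∀ i, f (star (e i) * e i) = 1)
    (h2 : ∀ i j, i ≠ j → f (star (e i) * e j) = 0) (x : StdModule.finSupp ι B) :
    ‖(CStarInner.self (CStarTensor A B)).toEnveloping (f.prod η) (δ.finSuppMap e x)‖ =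
      ‖(StdModule.inner ι B).toEnveloping η x.1‖ := by
  have hs : ∀ i ∉ x.2.toFinset, x.1.1 i = 0 := fun i hi => by
    by_contra h; exact hi (x.2.mem_toFinset.2 h)
  refine (sq_eq_sq₀ (norm_nonneg _) (norm_nonneg _)).1 (Complex.ofReal_injective ?_)
  rw [CStarInner.norm_toEnveloping_sq, CStarInner.norm_toEnveloping_sq]
  change f.prod η (star (δ.finSuppMap e x) * δ.finSuppMap e x) =
    η (∑' i, star (x.1.1 i) * x.1.1 i)
  rw [tsum_eq_sum (s := x.2.toFinset) (fun i hi => by rw [hs i hi, mul_zero]),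
    finSuppMap_eq_sum δ e x hs, star_sum, Finset.sum_mul_sum, map_sum, map_sum]
  refine Finset.sum_congr rfl fun i hi => ?_
  rw [map_sum, Finset.sum_eq_single_of_mem i hi fun j _ hj => by
    rw [prod_star_mul δ hη, h2 i j hj.symm, zero_mul], prod_star_mul δ hη, h1, one_mul]

open scoped CStarAlgebra in
lemma denseRange_finSuppMap (δ : LeftCoaction G B) (η : CStarState B)
    (f : CStarState A) {e : ι → A} (he : Dense (Submodule.span ℂ (Set.range e) : Set A)) :
    DenseRange fun x => (CStarInner.self (CStarTensor A B)).toEnveloping (f.prod η)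
      (δ.finSuppMap e x) := by
  set T := (CStarInner.self (CStarTensor A B)).toEnveloping (f.prod η)
  have hT : Continuous T := CStarInner.continuous_toEnveloping_self _
  set K := (LinearMap.range (T ∘ₗ δ.finSuppMap e)).topologicalClosure with hK
  have hKc : IsClosed (K : Set (EnvelopingSpace (CStarInner.self (CStarTensor A B)) (f.prod η))) :=
    Submodule.isClosed_topologicalClosure _
  -- The closure `K` of the range is enlarged in stages: first the families supported at one index,
  -- then all `a` in `A` by density of the span of `e`, then all of `A ⊗ B` by density of `δ(B)(A ⊗
  -- 1)`.
  have h1 (b : B) (i : ι) : T (δ.hom b * CStarTensor.inl A B (e i)) ∈ K := by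
    refine Submodule.le_topologicalClosure _ ⟨⟨StdModule.truncate {i} fun _ => b,
      StdModule.truncate_mem_finSupp _ _⟩, ?_⟩
    rw [LinearMap.comp_apply, finSuppMap_eq_sum δ e _ (s := {i})
      fun j hj => StdModule.truncate_apply_of_notMem _ hj, Finset.sum_singleton,
      StdModule.truncate_apply_of_mem _ (Finset.mem_singleton_self i)]
  have h2 (b : B) (a : A) : T (δ.hom b * CStarTensor.inl A B a) ∈ K := by
    let L : A →ₗ[ℂ] CStarTensor A B :=
      LinearMap.mulLeft ℂ (δ.hom b) ∘ₗ (CStarTensor.inl A B).toAlgHom.toLinearMap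
    have hL : Continuous L := continuous_const.mul (map_continuous (CStarTensor.inl A B))
    have hle : Submodule.span ℂ (Set.range e) ≤ K.comap (T ∘ₗ L) := by
      rw [Submodule.span_le]
      rintro _ ⟨i, rfl⟩
      exact h1 b i
    exact closure_minimal hle (hKc.preimage (hT.comp hL)) (he a)
  have h3 (x : CStarTensor A B) : T x ∈ K := by
    have hle : Submodule.span ℂ {x | ∃ b a, x = δ.hom b * CStarTensor.inl A B a} ≤ K.comap T := by
      rw [Submodule.span_le]
      rintro _ ⟨b, a, rfl⟩
      exact h2 b a
    exact closure_minimal hle (hKc.preimage hT) (δ.dense x)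
  intro y
  exact closure_minimal (Set.range_subset_iff.2 h3) hKc
    (CStarInner.denseRange_toEnveloping _ (f.prod η) y)

end LeftCoaction

end

theorem mainTheorem8 {A B : Type u} [CStarAlgebra A] [TopologicalSpace.SeparableSpace A]
    [CStarAlgebra B] (hA : IsNuclear A) (G : CompactQuantumGroup A)
    (f : CStarState A) (hf : f.IsFaithful) (hfG : G.IsRightInvariant f)
    (δ : LeftCoaction G B) (η : CStarState B) (hη : η.IsFaithful) (hηδ : δ.IsInvariant η)
    (ι : Type) [Countable ι] (hι : ENat.card ι = Cardinal.toENat (Module.rank ℂ A)) :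
    (f.prod η).IsFaithful ∧
    ∃ W : StdModule ι B →ₗ.[ℂ] CStarTensor A B,
      (∀ x : StdModule ι B, (Function.support (x : ι → B)).Finite → x ∈ W.domain) ∧
      (∀ (b : B) (x : W.domain), ∃ h : StdModule.lmul b (x : StdModule ι B) ∈ W.domain,
        W ⟨StdModule.lmul b x, h⟩ = δ.hom b * W x) ∧
      ∃ U : EnvelopingSpace (StdModule.inner ι B) η ≃ₗᵢ[ℂ]
          EnvelopingSpace (CStarInner.self (CStarTensor A B)) (f.prod η),
        ∀ x : W.domain,
          U ((StdModule.inner ι B).toEnveloping η x) =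
            (CStarInner.self (CStarTensor A B)).toEnveloping (f.prod η) (W x) := by
  refine ⟨hf.prod hA hη, ?_⟩
  obtain ⟨e, h1, h2, he⟩ := hf.exists_orthonormal hι
  have hd := StdModule.denseRange_toEnveloping_finSupp (ι := ι) η
  have hd' := δ.denseRange_finSuppMap η f he
  obtain ⟨U, hU⟩ := CStarInner.exists_unitary_of_norm_eq (StdModule.inner ι B) η
    (CStarInner.self (CStarTensor A B)) (f.prod η) (StdModule.finSupp ι B)
    (δ.finSuppMap e) hd hd' fun x => δ.norm_finSuppMap hηδ f h1 h2 x
  -- The isometry concerns the scalar norms only and does not make the sum defining `W` converge in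
  -- `A ⊗ B`, so the domain is kept to finitely supported families.
  exact ⟨⟨StdModule.finSupp ι B, δ.finSuppMap e⟩, fun x hx => hx, fun b x =>
    ⟨StdModule.lmul_mem_finSupp b x.2, δ.finSuppMap_lmul e b x _⟩, U, hU⟩
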